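/- Let $M\ge 1$ be an integer and consider sequences $c=(c_i)_{i\ge1}\in\{0,1,\dots,M\}^{\infty}$. An expansion of a real number $x$ in base $q>1$ is a sequence $c$ with $\sum_{i\ge1}c_iq^{-i}=x$. Let $q'=q'(M)$ be the Komornik--Loreti constant, i.e. the smallest $q>1$ in which $x=1$ has a unique expansion. For $q\in[q',M+1]$ let $\beta(q)=(\beta_i(q))$ be the lexicographically largest expansion of $1$ in base $q$ (greedy expansion), and let $\alpha(q)=(\alpha_i(q))$ be the lexicographically largest expansion of $1$ in base $q$ having infinitely many nonzero digits (quasi-greedy expansion). For a sequence or a word $c$ write $\overline{c}=(M-c_i)$, and compare sequences, and words of equal length, lexicographically. Define $$\widetilde{\mathcal U}_q'=\{c:\ \overline{\alpha(q)}<(c_{m+i})_{i\ge1}<\alpha(q)\ \text{for all } m\ge0\},$$ $$\widetilde{\mathcal V}_q'=\{c:\ \overline{\alpha(q)}\le(c_{m+i})_{i\ge1}\le\alpha(q)\ \text{for all } m\ge0\},$$ and for each integer $n\ge1$ $$\widetilde{\mathcal U}_{q,n}'=\{c:\ \overline{\alpha_1(q)\cdots\alpha_n(q)}<c_{m+1}\cdots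 c_{m+n}<\alpha_1(q)\cdots\alpha_n(q)\ \text{for all } m\ge0\},$$ $$\widetilde{\mathcal V}_{q,n}'=\{c:\ \overline{\alpha_1(q)\cdots\alpha_n(q)}\le c_{m+1}\cdots c_{m+n}\le\alpha_1(q)\cdots\alpha_n(q)\ \text{for all } m\ge0\},$$ $$\widetilde{\mathcal W}_{q,n}'=\{c:\ \overline{\beta_1(q)\cdots\beta_n(q)}\le c_{m+1}\cdots c_{m+n}\le\beta_1(q)\cdots\beta_n(q)\ \text{for all } m\ge0\}.$$ For a nonempty set $S$ of sequences let $B_k(S)$ be the set of initial words of length $k$ of the elements of $S$, and let $$h(S)=\lim_{k\to\infty}\frac{\log_2|B_k(S)|}{k}$$ whenever this limit exists. Proposition. Let $q\in[q',M+1]$. The sets $\widetilde{\mathcal U}_q'$, $\widetilde{\mathcal V}_q'$ and, for every $n\ge1$, $\widetilde{\mathcal V}_{q,n}'$ and $\widetilde{\mathcal W}_{q,n}'$ are nonempty, $\widetilde{\mathcal U}_{q,n}'$ is nonempty for all sufficiently large $n$, and the entropy $h$ of each of these sets (of $\widetilde{\mathcal U}_{q,n}'$ whenever it is nonempty) exists.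 Moreover, $$\lim_{n\to\infty}h(\widetilde{\mathcal U}_{q,n}')=\lim_{n\to\infty}h(\widetilde{\mathcal V}_{q,n}')=\lim_{n\to\infty}h(\widetilde{\mathcal W}_{q,n}')=h(\widetilde{\mathcal U}_q')=h(\widetilde{\mathcal V}_q').$$ -/

import Mathlib

open Filter Topology

namespace Univoque

/-- Sequences over the alphabet `{0, 1, …, M}`. The digit `c_{i+1}` of the usual 1-based numbering
is `c i`. -/
abbrev DigitSeq (M : ℕ) := ℕ → Fin (M + 1)

/-- Words of length `n` over the alphabet `{0, 1, …, M}`. Words of the same length, and sequences,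
are compared lexicographically, that is, through `toLex`. -/
abbrev Word (M n : ℕ) := Fin n → Fin (M + 1)

/-- `c` is an expansion of `x` in base `q`, i.e. `x = ∑_{i ≥ 1} c_i / q ^ i`. -/
def IsExpansion (M : ℕ) (q x : ℝ) (c : DigitSeq M) : Prop :=
  HasSum (fun i : ℕ => ((c i : ℕ) : ℝ) / q ^ (i + 1)) x

/-- The set of bases `q > 1` in which `x = 1` has a unique expansion. -/
def univoqueBases (M : ℕ) : Set ℝ :=
  {q | 1 < q ∧ ∃! c : DigitSeq M, IsExpansion M q 1 c}

/-- The Komornik--Loreti constant `q'`: the smallest base in which `x = 1` has a unique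
expansion. -/
noncomputable def komornikLoreti (M : ℕ) : ℝ := sInf (univoqueBases M)

/-- `b` is the lexicographically largest expansion of `1` in base `q`. -/
def IsGreedy (M : ℕ) (q : ℝ) (b : DigitSeq M) : Prop :=
  IsExpansion M q 1 b ∧ ∀ c : DigitSeq M, IsExpansion M q 1 c → toLex c ≤ toLex b

/-- `c` has infinitely many nonzero digits. -/
def IsInfinite {M : ℕ} (c : DigitSeq M) : Prop := {i | c i ≠ 0}.Infinite

/-- `a` is the lexicographically largest infinite expansion of `1` in base `q`. -/
def IsQuasiGreedy (M : ℕ) (q : ℝ) (a : DigitSeq M) : Prop :=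
  (IsExpansion M q 1 a ∧ IsInfinite a) ∧
    ∀ c : DigitSeq M, IsExpansion M q 1 c → IsInfinite c → toLex c ≤ toLex a

/-- The greedy expansion `β(q)` of `1`; such a sequence exists for `1 < q ≤ M + 1` and is always
unique. -/
noncomputable def beta (M : ℕ) (q : ℝ) : DigitSeq M := Classical.epsilon (IsGreedy M q)

/-- The quasi-greedy expansion `α(q)` of `1`; such a sequence exists for `1 < q ≤ M + 1` and is
always unique. -/
noncomputable def alpha (M : ℕ) (q : ℝ) : DigitSeq M := Classical.epsilon (IsQuasiGreedy M q)

/-- The tail `c_{m+1} c_{m+2} ⋯`. -/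
def tail {M : ℕ} (c : DigitSeq M) (m : ℕ) : DigitSeq M := fun i => c (m + i)

/-- The block `c_{m+1} ⋯ c_{m+n}`. -/
def block {M : ℕ} (c : DigitSeq M) (m n : ℕ) : Word M n := fun i => c (m + i)

/-- The reflection `(M - c_i)` of a sequence (`Fin.rev` is `d ↦ M - d` on `Fin (M + 1)`). -/
def refl {M : ℕ} (c : DigitSeq M) : DigitSeq M := fun i => (c i).rev

/-- The set `Ũ_q'`. -/
def setU (M : ℕ) (q : ℝ) : Set (DigitSeq M) :=
  {c | ∀ m : ℕ, toLex (refl (alpha M q)) < toLex (tail c m) ∧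
    toLex (tail c m) < toLex (alpha M q)}

/-- The set `Ṽ_q'`. -/
def setV (M : ℕ) (q : ℝ) : Set (DigitSeq M) :=
  {c | ∀ m : ℕ, toLex (refl (alpha M q)) ≤ toLex (tail c m) ∧
    toLex (tail c m) ≤ toLex (alpha M q)}

/-- The set `Ũ_{q,n}'`. -/
def setUn (M : ℕ) (q : ℝ) (n : ℕ) : Set (DigitSeq M) :=
  {c | ∀ m : ℕ, toLex (block (refl (alpha M q)) 0 n) < toLex (block c m n) ∧
    toLex (block c m n) < toLex (block (alpha M q) 0 n)}

/-- The set `Ṽ_{q,n}'`. -/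
def setVn (M : ℕ) (q : ℝ) (n : ℕ) : Set (DigitSeq M) :=
  {c | ∀ m : ℕ, toLex (block (refl (alpha M q)) 0 n) ≤ toLex (block c m n) ∧
    toLex (block c m n) ≤ toLex (block (alpha M q) 0 n)}

/-- The set `W̃_{q,n}'`. -/
def setWn (M : ℕ) (q : ℝ) (n : ℕ) : Set (DigitSeq M) :=
  {c | ∀ m : ℕ, toLex (block (refl (beta M q)) 0 n) ≤ toLex (block c m n) ∧
    toLex (block c m n) ≤ toLex (block (beta M q) 0 n)}

/-- `B_k(S)`: the initial words of length `k` of the sequences in `S`. -/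
def words {M : ℕ} (S : Set (DigitSeq M)) (k : ℕ) : Set (Word M k) :=
  (fun c => block c 0 k) '' S

/-- `log |B_k(S)| / k`, with the base two logarithm. -/
noncomputable def entropyRate {M : ℕ} (S : Set (DigitSeq M)) (k : ℕ) : ℝ :=
  Real.logb 2 ((words S k).ncard : ℝ) / (k : ℝ)

/-- The topological entropy `h(S) = lim_{k → ∞} log |B_k(S)| / k`. -/
noncomputable def entropy {M : ℕ} (S : Set (DigitSeq M)) : ℝ := limUnder atTop (entropyRate S)

/-- The entropy of `S` is well defined: `S` is nonempty, so that the logarithms make sense, and the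
limit defining `h(S)` exists. -/
def EntropyDefined {M : ℕ} (S : Set (DigitSeq M)) : Prop :=
  S.Nonempty ∧ Tendsto (entropyRate S) atTop (𝓝 (entropy S))

end Univoque

/-!
Write `symmShift t` for the set of sequences whose tails all lie between the reflection of `t` and
`t`, so that `setV M q = symmShift (alpha M q)`. All the sets in question are shift-invariant, so
their word counts are submultiplicative and the entropies exist by Fekete's lemma. Blockwise
conditions with weak inequalities define decreasing sequences of closed sets, along which the entropy
is continuous by compactness; the intersection is `symmShift (alpha M q)` both for `setVn` and for
`setWn`, because a sequence whose tails stay between the reflection of `beta` and `beta` has value at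
most `1` and is infinite unless `alpha = beta` (`symmShift_beta_eq`).

The substance is that the strict approximations `setUn M q n` exhaust the entropy of
`symmShift (alpha M q)` (`exists_lt_entropy_strictShift`). Call `t` admissible if
`t ∈ symmShift t`. The word counts `A k` of `symmShift t` then satisfy the renewal equation
`A k = 1 + ∑ j < k, (2 t_j - M) A (k - 1 - j)` (`ncard_words_eq`), so that their generating function
is `1 / ((1 - z) (1 - ρ z))` with `ρ z = ∑ (2 t_j - M) z ^ (j + 1)`. Let `a = alpha M q`.

* If `a` is not admissible, then `symmShift a` has a largest element smaller than `a`, and some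
  `setUn M q n` contains `symmShift a`.
* If `a` is admissible and infinitely many initial words of `a` have no proper suffix that is a
  reflected prefix (`ReflFree`), then lowering the last digit of such a word and repeating it
  periodically gives elements of the sets `setUn M q n` close to `a`. Hence
  `setUn M q n = symmShift (t n)` with `t n` admissible and `t n → a`. Were the entropies bounded
  away from that of `symmShift a`, the generating functions of the `t n` would converge at a point
  where that of `a` diverges but `1 - ρ` does not vanish, and their values there would stay bounded;
  since the coefficients converge, this is absurd (`exists_lt_entropy_of_tendsto`).
* Otherwise `a = w w̄ w w̄ ⋯` for the longest such word `w`, and the periodic sequence `t` obtained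
  from `w` by lowering the last digit satisfies
  `(1 - ρ_a) (1 + z ^ N) = (1 - ρ_t) (1 - z ^ N)`, where `N` is the length of `w`; the word counts of
  `a` and of `t` therefore differ by at most a linear factor, and the entropies agree
  (`numWords_le_of_add_eq_rev`).

The hypothesis on `q` enters through the inequality of `base_bound`, a closed condition that holds in
every base in which `1` has a unique expansion. It says that `alpha M q` is larger than the periodic
sequence with period `⌈M / 2⌉ ⌊M / 2⌋`, which then lies in `setUn M q n` for large `n`.
-/

namespace Univoque

variable {M : ℕ}

/-! ### Lexicographic order of sequences and blocks -/

lemma lex_lt_iff {c d : DigitSeq M} :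
    toLex c < toLex d ↔ ∃ j, (∀ i < j, c i = d i) ∧ c j < d j := Iff.rfl

lemma block_lt_iff {c d : DigitSeq M} {m m' n : ℕ} :
    toLex (block c m n) < toLex (block d m' n) ↔
      ∃ j < n, (∀ i < j, c (m + i) = d (m' + i)) ∧ c (m + j) < d (m' + j) := by
  constructor
  · rintro ⟨j, h1, h2⟩
    exact ⟨j, j.2, fun i hi => h1 ⟨i, hi.trans j.2⟩ hi, h2⟩
  · rintro ⟨j, hj, h1, h2⟩
    exact ⟨⟨j, hj⟩, fun i hi => h1 i hi, h2⟩

@[simp] lemma tail_zero (c : DigitSeq M) : tail c 0 = c := by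
  funext i; simp [tail]

@[simp] lemma tail_tail (c : DigitSeq M) (m n : ℕ) : tail (tail c m) n = tail c (m + n) := by
  funext i; simp [tail, add_assoc]

@[simp] lemma block_tail (c : DigitSeq M) (m l n : ℕ) :
    block (tail c m) l n = block c (m + l) n := by
  funext i; simp [tail, block, add_assoc]

@[simp] lemma refl_refl (c : DigitSeq M) : refl (refl c) = c := by
  funext i; simp [refl]

@[simp] lemma tail_refl (c : DigitSeq M) (m : ℕ) : tail (refl c) m = refl (tail c m) := rfl

lemma refl_lt_refl {c d : DigitSeq M} : toLex (refl c) < toLex (refl d) ↔ toLex d < toLex c := by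
  simp only [lex_lt_iff, refl, Fin.rev_inj, Fin.rev_lt_rev, eq_comm]

lemma refl_le_refl {c d : DigitSeq M} : toLex (refl c) ≤ toLex (refl d) ↔ toLex d ≤ toLex c := by
  exact not_lt.symm.trans ((not_congr refl_lt_refl).trans not_lt)

lemma block_refl_lt_block_refl {c d : DigitSeq M} {m m' n : ℕ} :
    toLex (block (refl c) m n) < toLex (block (refl d) m' n) ↔
      toLex (block d m' n) < toLex (block c m n) := by
  simp only [block_lt_iff, refl, Fin.rev_inj, Fin.rev_lt_rev, eq_comm]

lemma block_eq_iff {c d : DigitSeq M} {m m' n : ℕ} :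
    block c m n = block d m' n ↔ ∀ i < n, c (m + i) = d (m' + i) :=
  ⟨fun h i hi => congrFun h ⟨i, hi⟩, fun h => funext fun i => h i i.2⟩

lemma block_lt_mono {c d : DigitSeq M} {m m' n n' : ℕ} (hn : n ≤ n')
    (h : toLex (block c m n) < toLex (block d m' n)) :
    toLex (block c m n') < toLex (block d m' n') := by
  rw [block_lt_iff] at *
  obtain ⟨j, hj, h⟩ := h
  exact ⟨j, hj.trans_le hn, h⟩

lemma block_le_anti {c d : DigitSeq M} {m m' n n' : ℕ} (hn : n ≤ n')
    (h : toLex (block c m n') ≤ toLex (block d m' n')) :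
    toLex (block c m n) ≤ toLex (block d m' n) := by
  by_contra hc
  exact absurd (block_lt_mono hn (not_le.1 hc)) (not_lt.2 h)

lemma tail_lt_tail_iff {c d : DigitSeq M} {m m' : ℕ} :
    toLex (tail c m) < toLex (tail d m') ↔
      ∃ n, toLex (block c m n) < toLex (block d m' n) := by
  simp only [block_lt_iff, lex_lt_iff, tail]
  constructor
  · rintro ⟨j, h⟩
    exact ⟨j + 1, j, Nat.lt_succ_self j, h⟩
  · rintro ⟨n, j, -, h⟩
    exact ⟨j, h⟩

lemma tail_le_tail_iff {c d : DigitSeq M} {m m' : ℕ} :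
    toLex (tail c m) ≤ toLex (tail d m') ↔
      ∀ n, toLex (block c m n) ≤ toLex (block d m' n) := by
  exact not_lt.symm.trans ((not_congr tail_lt_tail_iff).trans
    (not_exists.trans (forall_congr' fun _ => not_lt)))

lemma lt_iff_exists_block {c d : DigitSeq M} :
    toLex c < toLex d ↔ ∃ n, toLex (block c 0 n) < toLex (block d 0 n) := by
  simpa using tail_lt_tail_iff (c := c) (d := d) (m := 0) (m' := 0)

lemma le_iff_forall_block {c d : DigitSeq M} :
    toLex c ≤ toLex d ↔ ∀ n, toLex (block c 0 n) ≤ toLex (block d 0 n) := by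
  simpa using tail_le_tail_iff (c := c) (d := d) (m := 0) (m' := 0)

/-! ### Values of sequences -/

/-- The value `∑ c_i / b ^ i` of a digit sequence in base `b`. -/
noncomputable def val (b : ℝ) (c : DigitSeq M) : ℝ := ∑' i, ((c i : ℕ) : ℝ) / b ^ (i + 1)

lemma digit_le (c : DigitSeq M) (i : ℕ) : ((c i : ℕ) : ℝ) ≤ M := by
  exact_mod_cast Nat.lt_succ_iff.1 (c i).2

lemma hasSum_geom {b : ℝ} (hb : 1 < b) (x : ℝ) :
    HasSum (fun i : ℕ => x / b ^ (i + 1)) (x / (b - 1)) := by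
  have h := (hasSum_geometric_of_lt_one (r := b⁻¹) (by positivity)
    (inv_lt_one_of_one_lt₀ hb)).mul_left (x / b)
  have h0 : b ≠ 0 := by positivity
  have h1 : b - 1 ≠ 0 := by linarith
  have h2 : x / b * (1 - b⁻¹)⁻¹ = x / (b - 1) := by
    rw [show 1 - b⁻¹ = (b - 1) / b by field_simp, inv_div]; field_simp
  rw [h2] at h
  refine h.congr_fun fun i => ?_
  rw [inv_pow, pow_succ]; field_simp

lemma summable_val {b : ℝ} (hb : 1 < b) (c : DigitSeq M) :
    Summable (fun i : ℕ => ((c i : ℕ) : ℝ) / b ^ (i + 1)) := by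
  refine Summable.of_nonneg_of_le (fun i => by positivity) (fun i => ?_) (hasSum_geom hb M).summable
  gcongr
  exact Nat.lt_succ_iff.1 (c i).2

lemma isExpansion_iff {b x : ℝ} (hb : 1 < b) {c : DigitSeq M} :
    IsExpansion M b x c ↔ val b c = x :=
  ⟨fun h => h.tsum_eq, fun h => h ▸ (summable_val hb c).hasSum⟩

lemma val_nonneg {b : ℝ} (hb : 1 < b) (c : DigitSeq M) : 0 ≤ val b c :=
  tsum_nonneg fun i => by positivity

lemma val_le {b : ℝ} (hb : 1 < b) (c : DigitSeq M) : val b c ≤ M / (b - 1) :=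
  (hasSum_geom hb (M : ℝ)).tsum_eq ▸
    (summable_val hb c).tsum_le_tsum (fun i => by gcongr; exact Nat.lt_succ_iff.1 (c i).2)
      (hasSum_geom hb (M : ℝ)).summable

lemma val_pos {b : ℝ} (hb : 1 < b) {c : DigitSeq M} {i : ℕ} (h : c i ≠ 0) : 0 < val b c := by
  refine (summable_val hb c).tsum_pos (fun i => by positivity) i ?_
  have : 0 < (c i : ℕ) := Nat.pos_of_ne_zero fun h' => h (Fin.ext h')
  positivity

lemma val_split {b : ℝ} (hb : 1 < b) (c : DigitSeq M) (n : ℕ) :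
    val b c = (∑ i ∈ Finset.range n, ((c i : ℕ) : ℝ) / b ^ (i + 1)) + val b (tail c n) / b ^ n := by
  rw [val, ← (summable_val hb c).sum_add_tsum_nat_add n, val, ← tsum_div_const]
  congr 1
  refine tsum_congr fun i => ?_
  simp only [tail]
  rw [add_comm n i, div_div, ← pow_add]
  congr 2; ring

lemma val_succ {b : ℝ} (hb : 1 < b) (c : DigitSeq M) :
    val b c = (((c 0 : ℕ) : ℝ) + val b (tail c 1)) / b := by
  rw [val_split hb c 1]; simp [add_div]

lemma val_tail {b : ℝ} (hb : 1 < b) (c : DigitSeq M) (n : ℕ) :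
    val b (tail c (n + 1)) = b * val b (tail c n) - ((c n : ℕ) : ℝ) := by
  have hb0 : b ≠ 0 := by positivity
  have h := val_succ hb (tail c n)
  rw [tail_tail] at h
  rw [h]
  simp only [tail, add_zero]
  field_simp
  ring

/-- Sequences that agree before position `j` have values whose difference is governed by the digits
at `j` and by the values of the tails. -/
lemma val_sub_val {b : ℝ} (hb : 1 < b) {c d : DigitSeq M} {j : ℕ} (h : ∀ i < j, c i = d i) :
    val b d - val b c = (((d j : ℕ) : ℝ) - ((c j : ℕ) : ℝ) +
      (val b (tail d (j + 1)) - val b (tail c (j + 1)))) / b ^ (j + 1) := by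
  have h1 : ∑ i ∈ Finset.range j, ((c i : ℕ) : ℝ) / b ^ (i + 1) =
      ∑ i ∈ Finset.range j, ((d i : ℕ) : ℝ) / b ^ (i + 1) :=
    Finset.sum_congr rfl fun i hi => by rw [h i (Finset.mem_range.1 hi)]
  rw [val_split hb c (j + 1), val_split hb d (j + 1), Finset.sum_range_succ, Finset.sum_range_succ,
    h1]
  ring

lemma continuous_val {b : ℝ} (hb : 1 < b) : Continuous (val b : DigitSeq M → ℝ) := by
  refine continuous_tsum (u := fun i : ℕ => (M : ℝ) / b ^ (i + 1)) (fun i => ?_)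
    (hasSum_geom hb (M : ℝ)).summable (fun i c => ?_)
  · exact (continuous_of_discreteTopology
      (f := fun x : Fin (M + 1) => ((x : ℕ) : ℝ) / b ^ (i + 1))).comp (continuous_apply i)
  · rw [Real.norm_of_nonneg (by positivity)]
    gcongr
    exact Nat.lt_succ_iff.1 (c i).2

/-- In a base larger than `M + 1` the lexicographic order is the order of the values. -/
lemma val_lt_val_of_lt {c d : DigitSeq M} (h : toLex c < toLex d) :
    val ((M : ℝ) + 2) c < val ((M : ℝ) + 2) d := by
  obtain ⟨j, h1, h2⟩ := lex_lt_iff.1 h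
  have hb : (1 : ℝ) < (M : ℝ) + 2 := by have : (0 : ℝ) ≤ M := by positivity
                                        linarith
  rw [← sub_pos, val_sub_val hb h1]
  refine div_pos ?_ (by positivity)
  have h3 : ((c j : ℕ) : ℝ) + 1 ≤ ((d j : ℕ) : ℝ) := by exact_mod_cast h2
  have h4 := val_nonneg hb (tail d (j + 1))
  have h5 : val ((M : ℝ) + 2) (tail c (j + 1)) < 1 := (val_le hb _).trans_lt <| by
    rw [div_lt_one (by linarith)]; linarith
  linarith

lemma val_le_val_iff {c d : DigitSeq M} :
    val ((M : ℝ) + 2) c ≤ val ((M : ℝ) + 2) d ↔ toLex c ≤ toLex d := by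
  refine ⟨fun h => ?_, fun h => ?_⟩
  · by_contra hc
    exact absurd (val_lt_val_of_lt (not_le.1 hc)) (not_lt.2 h)
  · rcases h.lt_or_eq with h | h
    · exact (val_lt_val_of_lt h).le
    · rw [toLex.injective h]

/-- A nonempty closed set of sequences has a lexicographically largest element: maximize the value in
base `M + 2` over this compact set. -/
lemma exists_max_of_isClosed {S : Set (DigitSeq M)} (hS : IsClosed S) (hne : S.Nonempty) :
    ∃ t ∈ S, ∀ c ∈ S, toLex c ≤ toLex t := by
  have hb : (1 : ℝ) < (M : ℝ) + 2 := by have : (0 : ℝ) ≤ M := by positivity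
                                        linarith
  obtain ⟨t, ht, hmax⟩ := hS.isCompact.exists_isMaxOn hne (continuous_val hb).continuousOn
  exact ⟨t, ht, fun c hc => val_le_val_iff.1 (hmax hc)⟩

lemma continuous_block (m n : ℕ) : Continuous fun c : DigitSeq M => block c m n :=
  continuous_pi fun _ => continuous_apply _

/-- A set of sequences described by conditions on their blocks of a given length is closed. -/
lemma isClosed_setOf_block {n : ℕ} (P : Word M n → Prop) :
    IsClosed {c : DigitSeq M | ∀ m, P (block c m n)} := by
  simp only [Set.ofPred_forall]
  exact isClosed_iInter fun m =>
    (isClosed_discrete {w | P w}).preimage (continuous_block m n)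

/-! ### Greedy and quasi-greedy expansions -/

/-- The value of a sequence can be read off from any bounded orbit that produces its digits. -/
lemma val_eq_of_orbit {b : ℝ} (hb : 1 < b) {c : DigitSeq M} {r : ℕ → ℝ} {C : ℝ}
    (hr : ∀ n, r (n + 1) = b * r n - ((c n : ℕ) : ℝ)) (hC : ∀ n, |r n| ≤ C) (n : ℕ) :
    val b (tail c n) = r n := by
  have h0 : ∀ n k, r (n + k) - val b (tail c (n + k)) = b ^ k * (r n - val b (tail c n)) := by
    intro n k
    induction k with
    | zero => simp
    | succ k ih => rw [← add_assoc, hr, val_tail hb, pow_succ]; linear_combination b * ih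
  by_contra hne
  have hpos : 0 < |r n - val b (tail c n)| := abs_pos.2 (sub_ne_zero.2 (Ne.symm hne))
  obtain ⟨k, hk⟩ := ((tendsto_pow_atTop_atTop_of_one_lt hb).eventually_gt_atTop
    ((C + M / (b - 1)) / |r n - val b (tail c n)|)).exists
  rw [div_lt_iff₀ hpos] at hk
  have h1 : |r (n + k) - val b (tail c (n + k))| ≤ C + M / (b - 1) :=
    (abs_sub _ _).trans (add_le_add (hC _)
      ((abs_of_nonneg (val_nonneg hb _)).le.trans (val_le hb _)))
  rw [h0, abs_mul, abs_of_nonneg (by positivity)] at h1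
  linarith

lemma exists_orbit {b : ℝ} {P : ℝ → Prop} {x : ℝ} (hx : P x)
    (h : ∀ r, P r → ∃ d : Fin (M + 1), P (b * r - ((d : ℕ) : ℝ))) :
    ∃ (c : DigitSeq M) (r : ℕ → ℝ), r 0 = x ∧ (∀ n, P (r n)) ∧
      ∀ n, r (n + 1) = b * r n - ((c n : ℕ) : ℝ) := by
  choose! D hD using h
  let R : ℕ → ℝ := fun n => Nat.rec x (fun _ r => b * r - ((D r : ℕ) : ℝ)) n
  have hR : ∀ n, P (R n) := by
    intro n
    induction n with
    | zero => exact hx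
    | succ n ih => exact hD _ ih
  exact ⟨fun n => D (R n), R, rfl, hR, fun n => rfl⟩

/-- The greedy algorithm, with digits capped at `M`. -/
lemma exists_val_eq {b : ℝ} (hb : 1 < b) (hbM : b ≤ M + 1) {x : ℝ} (h0 : 0 ≤ x)
    (h1 : x ≤ M / (b - 1)) : ∃ c : DigitSeq M, val b c = x := by
  have hb1 : 0 < b - 1 := by linarith
  obtain ⟨c, r, hr0, hr, hrec⟩ := exists_orbit (M := M) (b := b)
    (P := fun r => 0 ≤ r ∧ r ≤ M / (b - 1)) ⟨h0, h1⟩ (by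
      rintro r ⟨hr0, hr1⟩
      rcases le_or_gt (M : ℝ) (b * r) with h | h
      · refine ⟨Fin.last M, by simpa using h, ?_⟩
        rw [le_div_iff₀ hb1] at hr1 ⊢
        simp only [Fin.val_last]
        nlinarith
      · have hf : ⌊b * r⌋₊ < M + 1 := by
          have := Nat.floor_lt' (a := b * r) (n := M + 1) (by omega)
          rw [this]; push_cast; linarith
        refine ⟨⟨⌊b * r⌋₊, hf⟩, ?_, ?_⟩
        · exact sub_nonneg.2 (Nat.floor_le (by positivity))
        · have h2 : (1 : ℝ) ≤ M / (b - 1) := by rw [le_div_iff₀ hb1]; linarith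
          have h3 := Nat.lt_floor_add_one (b * r)
          simp only
          linarith)
  refine ⟨c, ?_⟩
  rw [← hr0, ← tail_zero c]
  exact val_eq_of_orbit hb hrec (fun n => (abs_of_nonneg (hr n).1).le.trans (hr n).2) 0

lemma isInfinite_iff {b : ℝ} (hb : 1 < b) {c : DigitSeq M} :
    IsInfinite c ↔ ∀ n, 0 < val b (tail c n) := by
  constructor
  · intro h n
    obtain ⟨i, hi, hni⟩ := h.exists_gt n
    refine val_pos hb (i := i - n) ?_
    simpa [tail, Nat.add_sub_cancel' hni.le] using hi
  · intro h hfin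
    obtain ⟨n, hn⟩ := hfin.bddAbove
    refine absurd (h (n + 1)) (not_lt.2 (le_of_eq ?_))
    have : ∀ i, ((tail c (n + 1) i : ℕ) : ℝ) / b ^ (i + 1) = 0 := by
      intro i
      have : c (n + 1 + i) = 0 := by
        by_contra hc
        have := hn hc
        omega
      simp [tail, this]
    simp only [val, this, tsum_zero]

/-- An expansion of `1` all of whose tails have value at most `1` dominates every infinite sequence
of value at most `1`. -/
lemma le_of_val_le_one {b : ℝ} (hb : 1 < b) {a c : DigitSeq M} (ha : val b a = 1)
    (hat : ∀ n, val b (tail a n) ≤ 1) (hc : IsInfinite c) (hc1 : val b c ≤ 1) :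
    toLex c ≤ toLex a := by
  by_contra hlt
  obtain ⟨j, h1, h2⟩ := lex_lt_iff.1 (not_le.1 hlt)
  have h3 := val_sub_val hb h1
  have h4 : ((a j : ℕ) : ℝ) + 1 ≤ ((c j : ℕ) : ℝ) := by exact_mod_cast h2
  have h5 := (isInfinite_iff hb).1 hc (j + 1)
  have h6 := hat (j + 1)
  have h7 : 0 < val b c - val b a := by
    rw [h3]
    exact div_pos (by linarith) (by positivity)
  linarith

/-- The quasi-greedy algorithm, which keeps all remainders in `(0, 1]`. -/
lemma exists_quasiGreedy {q : ℝ} (hq : 1 < q) (hqM : q ≤ M + 1) :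
    ∃ a : DigitSeq M, val q a = 1 ∧ ∀ n, 0 < val q (tail a n) ∧ val q (tail a n) ≤ 1 := by
  obtain ⟨c, r, hr0, hr, hrec⟩ := exists_orbit (M := M) (b := q)
    (P := fun r => 0 < r ∧ r ≤ 1) (x := 1) ⟨one_pos, le_rfl⟩ (by
      rintro r ⟨hr0, hr1⟩
      have hqr : 0 < q * r := by positivity
      have h1 : 0 < ⌈q * r⌉₊ := Nat.ceil_pos.2 hqr
      have h2 : ⌈q * r⌉₊ ≤ M + 1 := Nat.ceil_le.2 (by push_cast; nlinarith)
      have h3 : ((⌈q * r⌉₊ - 1 : ℕ) : ℝ) = ⌈q * r⌉₊ - 1 := by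
        rw [Nat.cast_sub h1]; simp
      have h4 := Nat.ceil_lt_add_one hqr.le
      have h5 := Nat.le_ceil (q * r)
      refine ⟨⟨⌈q * r⌉₊ - 1, by omega⟩, ?_⟩
      simp only [h3]
      exact ⟨by linarith, by linarith⟩)
  have hv := val_eq_of_orbit hq hrec (C := 1)
    (fun n => (abs_of_nonneg (hr n).1.le).le.trans (hr n).2)
  refine ⟨c, ?_, fun n => by rw [hv]; exact hr n⟩
  rw [← hr0, ← hv 0, tail_zero]

lemma isQuasiGreedy_alpha {q : ℝ} (hq : 1 < q) (hqM : q ≤ M + 1) :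
    IsQuasiGreedy M q (alpha M q) := by
  obtain ⟨a, ha1, ha⟩ := exists_quasiGreedy hq hqM
  refine Classical.epsilon_spec (p := IsQuasiGreedy M q) ⟨a, ⟨(isExpansion_iff hq).2 ha1,
    (isInfinite_iff hq).2 fun n => (ha n).1⟩, fun c hc hci => ?_⟩
  exact le_of_val_le_one hq ha1 (fun n => (ha n).2) hci ((isExpansion_iff hq).1 hc).le

lemma val_alpha {q : ℝ} (hq : 1 < q) (hqM : q ≤ M + 1) : val q (alpha M q) = 1 :=
  (isExpansion_iff hq).1 (isQuasiGreedy_alpha hq hqM).1.1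

lemma val_tail_alpha {q : ℝ} (hq : 1 < q) (hqM : q ≤ M + 1) (n : ℕ) :
    val q (tail (alpha M q) n) ≤ 1 := by
  obtain ⟨a, ha1, ha⟩ := exists_quasiGreedy hq hqM
  have hai : IsInfinite a := (isInfinite_iff hq).2 fun n => (ha n).1
  have h1 := (isQuasiGreedy_alpha hq hqM).2 a ((isExpansion_iff hq).2 ha1) hai
  have h2 := le_of_val_le_one hq ha1 (fun n => (ha n).2) (isQuasiGreedy_alpha hq hqM).1.2
    (val_alpha hq hqM).le
  rw [← toLex.injective (le_antisymm h1 h2)]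
  exact (ha n).2

lemma le_alpha {q : ℝ} (hq : 1 < q) (hqM : q ≤ M + 1) {c : DigitSeq M} (hc : IsInfinite c)
    (hc1 : val q c ≤ 1) : toLex c ≤ toLex (alpha M q) :=
  le_of_val_le_one hq (val_alpha hq hqM) (val_tail_alpha hq hqM) hc hc1

lemma isInfinite_tail {c : DigitSeq M} (hc : IsInfinite c) (n : ℕ) : IsInfinite (tail c n) := by
  have h2 : (1 : ℝ) < 2 := by norm_num
  rw [isInfinite_iff h2] at *
  intro m
  rw [tail_tail]
  exact hc _

lemma tail_alpha_le {q : ℝ} (hq : 1 < q) (hqM : q ≤ M + 1) (n : ℕ) :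
    toLex (tail (alpha M q) n) ≤ toLex (alpha M q) :=
  le_alpha hq hqM (isInfinite_tail (isQuasiGreedy_alpha hq hqM).1.2 n) (val_tail_alpha hq hqM n)

lemma isGreedy_beta {q : ℝ} (hq : 1 < q) (hqM : q ≤ M + 1) : IsGreedy M q (beta M q) := by
  obtain ⟨b, hb, hmax⟩ := exists_max_of_isClosed (S := {c : DigitSeq M | val q c = 1})
    (isClosed_eq (continuous_val hq) continuous_const) ⟨alpha M q, val_alpha hq hqM⟩
  exact Classical.epsilon_spec (p := IsGreedy M q)
    ⟨b, (isExpansion_iff hq).2 hb, fun c hc => hmax c ((isExpansion_iff hq).1 hc)⟩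

lemma alpha_le_beta {q : ℝ} (hq : 1 < q) (hqM : q ≤ M + 1) :
    toLex (alpha M q) ≤ toLex (beta M q) :=
  (isGreedy_beta hq hqM).2 _ (isQuasiGreedy_alpha hq hqM).1.1

/-- If all tails of `c` are lexicographically at most `d`, then the value of `c` is at most that of
`d`, provided the values of the tails of `d` do not drop more than `1` below that of `d`. -/
lemma val_le_val_of_tail_le {b : ℝ} (hb : 1 < b) {c d : DigitSeq M}
    (h : ∀ m, toLex (tail c m) ≤ toLex d) (hd : ∀ m, val b d ≤ 1 + val b (tail d m)) :
    val b c ≤ val b d := by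
  -- the excess of a tail of `c` over `d` is at most that of a later tail divided by `b`
  have key : ∀ n m, val b (tail c m) - val b d ≤ (M / (b - 1)) / b ^ n := by
    intro n
    induction n with
    | zero =>
      intro m
      have h1 := val_le hb (tail c m)
      have h2 := val_nonneg hb d
      simp only [pow_zero, div_one]
      linarith
    | succ n ih =>
      intro m
      rcases (h m).lt_or_eq with hlt | heq
      · obtain ⟨j, h1, h2⟩ := lex_lt_iff.1 hlt
        have h3 := val_sub_val hb h1
        have h4 : ((tail c m j : ℕ) : ℝ) + 1 ≤ ((d j : ℕ) : ℝ) := by exact_mod_cast h2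
        have h5 := ih (m + (j + 1))
        have h6 := hd (j + 1)
        rw [tail_tail] at h3
        have h7 : val b (tail c m) - val b d ≤
            (val b (tail c (m + (j + 1))) - val b d) / b ^ (j + 1) := by
          rw [← neg_sub, h3, ← neg_div]
          gcongr
          linarith
        have h8 : (M / (b - 1)) / b ^ n / b ^ (j + 1) ≤ (M / (b - 1)) / b ^ (n + 1) := by
          rw [div_div, ← pow_add]
          have : 0 ≤ (M : ℝ) / (b - 1) := div_nonneg (by positivity) (by linarith)
          exact div_le_div_of_nonneg_left this (by positivity)
            (pow_le_pow_right₀ hb.le (by omega))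
        refine h7.trans (le_trans ?_ h8)
        gcongr
      · rw [toLex.injective heq, sub_self]
        have : 0 < b - 1 := by linarith
        positivity
  have hlim : Tendsto (fun n : ℕ => (M / (b - 1)) / b ^ n) atTop (𝓝 0) :=
    tendsto_const_nhds.div_atTop (tendsto_pow_atTop_atTop_of_one_lt hb)
  have := ge_of_tendsto' hlim (fun n => key n 0)
  rw [tail_zero] at this
  linarith

/-- The bounds given by the greedy expansion of `1` imply those given by the quasi-greedy one: they
force the value to be at most `1`, and the sequence to be infinite. -/
lemma tail_le_alpha_of_tail_le_beta {q : ℝ} (hq : 1 < q) (hqM : q ≤ M + 1) {c : DigitSeq M}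
    (hc : ∀ m, toLex (refl (beta M q)) ≤ toLex (tail c m) ∧ toLex (tail c m) ≤ toLex (beta M q)) :
    toLex c ≤ toLex (alpha M q) := by
  have hβ : val q (beta M q) = 1 := (isExpansion_iff hq).1 (isGreedy_beta hq hqM).1
  by_cases hi : IsInfinite c
  · refine le_alpha hq hqM hi ?_
    rw [← hβ]
    refine val_le_val_of_tail_le hq (fun m => (hc m).2) fun m => ?_
    rw [hβ]
    have := val_nonneg hq (tail (beta M q) m)
    linarith
  · -- a finite sequence has a zero tail, which forces the greedy expansion to be `M M M ⋯`
    obtain ⟨n, hn⟩ := (Set.not_infinite.1 hi).bddAbove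
    have h0 : tail c (n + 1) = fun _ => 0 := by
      funext i
      by_contra h
      have := hn (show c (n + 1 + i) ≠ 0 from h)
      omega
    have h1 : beta M q = fun _ => Fin.last M := by
      have h2 := (hc (n + 1)).1
      rw [h0] at h2
      have h3 : refl (beta M q) = fun _ => 0 := by
        by_contra hne
        refine absurd h2 (not_le.2 (lt_of_le_of_ne ?_ fun h => hne (toLex.injective h).symm))
        exact Pi.toLex_monotone fun i => Fin.zero_le _
      rw [← refl_refl (beta M q), h3]
      funext i
      simp [refl]
    have h4 : IsInfinite (beta M q) := by
      have hβi : ∀ i, val q (tail (beta M q) i) = val q (beta M q) := fun i => by rw [h1]; rfl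
      exact (isInfinite_iff hq).2 fun i => by rw [hβi, hβ]; exact one_pos
    have h5 := (hc 0).2
    rw [tail_zero] at h5
    exact h5.trans (le_alpha hq hqM h4 hβ.le)

/-! ### Entropy of shift-invariant sets -/

/-- `S` contains all tails of its elements. -/
def ShiftInvariant (S : Set (DigitSeq M)) : Prop := ∀ c ∈ S, ∀ m, tail c m ∈ S

lemma block_mem_words {S : Set (DigitSeq M)} (hS : ShiftInvariant S) {c : DigitSeq M} (hc : c ∈ S)
    (m k : ℕ) : block c m k ∈ words S k :=
  ⟨tail c m, hS c hc m, by simp⟩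

lemma words_mono {S T : Set (DigitSeq M)} (h : S ⊆ T) (k : ℕ) : words S k ⊆ words T k :=
  Set.image_mono h

lemma ncard_words_mono {S T : Set (DigitSeq M)} (h : S ⊆ T) (k : ℕ) :
    (words S k).ncard ≤ (words T k).ncard :=
  Set.ncard_le_ncard (words_mono h k)

lemma one_le_ncard_words {S : Set (DigitSeq M)} (h : S.Nonempty) (k : ℕ) :
    1 ≤ (words S k).ncard :=
  (Set.ncard_pos).2 (h.image _)

lemma ncard_words_add_le {S : Set (DigitSeq M)} (hS : ShiftInvariant S) (m n : ℕ) :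
    (words S (m + n)).ncard ≤ (words S m).ncard * (words S n).ncard := by
  rw [← Set.ncard_prod]
  refine Set.ncard_le_ncard_of_injOn
    (fun w => (fun i => w (Fin.castAdd n i), fun i => w (Fin.natAdd m i))) ?_ ?_
  · rintro _ ⟨c, hc, rfl⟩
    refine ⟨⟨c, hc, rfl⟩, ?_⟩
    have := block_mem_words hS hc m n
    convert this using 1
    funext i
    simp [block]
  · intro v _ w _ h
    rw [Prod.mk.injEq] at h
    funext i
    refine Fin.addCases (fun i => congrFun h.1 i) (fun i => congrFun h.2 i) i

lemma ncard_words_mono_length (S : Set (DigitSeq M)) {m n : ℕ} (h : m ≤ n) :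
    (words S m).ncard ≤ (words S n).ncard := by
  have : words S m = (fun w : Word M n => fun i : Fin m => w (Fin.castLE h i)) '' words S n := by
    rw [words, words, Set.image_image]; rfl
  rw [this]
  exact Set.ncard_image_le

lemma subadditive_log_words {S : Set (DigitSeq M)} (hne : S.Nonempty) (hS : ShiftInvariant S) :
    Subadditive fun k => Real.logb 2 ((words S k).ncard : ℝ) := by
  intro m n
  have h1 : ∀ k, (0 : ℝ) < (words S k).ncard := fun k => by
    exact_mod_cast one_le_ncard_words hne k
  rw [← Real.logb_mul (h1 m).ne' (h1 n).ne']
  exact Real.logb_le_logb_of_le (by norm_num) (h1 _) (by exact_mod_cast ncard_words_add_le hS m n)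

lemma log_words_nonneg {S : Set (DigitSeq M)} (hne : S.Nonempty) (k : ℕ) :
    0 ≤ Real.logb 2 ((words S k).ncard : ℝ) :=
  Real.logb_nonneg (by norm_num) (by exact_mod_cast one_le_ncard_words hne k)

lemma entropyRate_nonneg {S : Set (DigitSeq M)} (hne : S.Nonempty) (k : ℕ) :
    0 ≤ entropyRate S k :=
  div_nonneg (log_words_nonneg hne k) (by positivity)

lemma bddBelow_entropyRate {S : Set (DigitSeq M)} (hne : S.Nonempty) :
    BddBelow (Set.range (entropyRate S)) :=
  ⟨0, by rintro _ ⟨k, rfl⟩; exact entropyRate_nonneg hne k⟩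

lemma entropyDefined {S : Set (DigitSeq M)} (hne : S.Nonempty) (hS : ShiftInvariant S) :
    EntropyDefined S :=
  ⟨hne, tendsto_nhds_limUnder
    ⟨_, (subadditive_log_words hne hS).tendsto_lim (bddBelow_entropyRate hne)⟩⟩

lemma entropy_le_entropyRate {S : Set (DigitSeq M)} (hne : S.Nonempty) (hS : ShiftInvariant S)
    {k : ℕ} (hk : k ≠ 0) : entropy S ≤ entropyRate S k := by
  have h := (subadditive_log_words hne hS).tendsto_lim (bddBelow_entropyRate hne)
  rw [tendsto_nhds_unique (entropyDefined hne hS).2 h]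
  exact (subadditive_log_words hne hS).lim_le_div (bddBelow_entropyRate hne) hk

lemma entropy_nonneg {S : Set (DigitSeq M)} (hne : S.Nonempty) (hS : ShiftInvariant S) :
    0 ≤ entropy S :=
  ge_of_tendsto' (entropyDefined hne hS).2 fun k => entropyRate_nonneg hne k

lemma entropy_mono {S T : Set (DigitSeq M)} (hne : S.Nonempty) (hS : ShiftInvariant S)
    (hT : ShiftInvariant T) (h : S ⊆ T) : entropy S ≤ entropy T := by
  refine le_of_tendsto_of_tendsto' (entropyDefined hne hS).2 (entropyDefined (hne.mono h) hT).2
    fun k => ?_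
  have h1 := one_le_ncard_words hne k
  refine div_le_div_of_nonneg_right ?_ (by positivity)
  exact Real.logb_le_logb_of_le (by norm_num) (by exact_mod_cast h1)
    (by exact_mod_cast ncard_words_mono h k)

/-- A factor that grows linearly in the number of words is not seen by the entropy. -/
lemma entropy_le_of_ncard_words_le {S T : Set (DigitSeq M)} (hSne : S.Nonempty)
    (hTne : T.Nonempty) (hS : ShiftInvariant S) (hT : ShiftInvariant T)
    (h : ∀ k, (words S k).ncard ≤ (2 * k + 1) * (words T k).ncard) : entropy S ≤ entropy T := by
  have hlim : Tendsto (fun k : ℕ => Real.logb 2 (2 * k + 1) / k) atTop (𝓝 0) := by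
    have h1 : Tendsto (fun x : ℝ => Real.log x / x) atTop (𝓝 0) :=
      Real.isLittleO_log_id_atTop.tendsto_div_nhds_zero
    have h2 : Tendsto (fun k : ℕ => (2 : ℝ) * k + 1) atTop atTop :=
      tendsto_atTop_add_const_right _ _
        (tendsto_natCast_atTop_atTop.const_mul_atTop (by norm_num))
    have h3 : Tendsto (fun k : ℕ => ((2 : ℝ) * k + 1) / k) atTop (𝓝 2) := by
      have h4 : Tendsto (fun k : ℕ => (2 : ℝ) + 1 / (k : ℝ)) atTop (𝓝 (2 + 0)) :=
        tendsto_const_nhds.add tendsto_one_div_atTop_nhds_zero_nat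
      rw [add_zero] at h4
      refine h4.congr' ?_
      filter_upwards [eventually_gt_atTop 0] with k hk
      field_simp
    have h5 := ((h1.comp h2).mul h3).div_const (Real.log 2)
    rw [zero_mul, zero_div] at h5
    refine h5.congr fun k => ?_
    have : (2 : ℝ) * k + 1 ≠ 0 := by positivity
    simp only [Function.comp, Real.logb]
    field_simp
  have h2 := hlim.add (entropyDefined hTne hT).2
  rw [zero_add] at h2
  refine le_of_tendsto_of_tendsto' (entropyDefined hSne hS).2 h2 fun k => ?_
  have h3 := one_le_ncard_words hSne k
  have h4 := one_le_ncard_words hTne k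
  rw [entropyRate, entropyRate, ← add_div, ← Real.logb_mul (by positivity) (by positivity)]
  refine div_le_div_of_nonneg_right ?_ (by positivity)
  exact Real.logb_le_logb_of_le (by norm_num) (by positivity) (by exact_mod_cast h k)

/-- The entropy is continuous along decreasing sequences of closed shift-invariant sets. -/
lemma tendsto_entropy_of_antitone {F : ℕ → Set (DigitSeq M)} {G : Set (DigitSeq M)}
    (hanti : Antitone F) (hclosed : ∀ n, IsClosed (F n)) (hinv : ∀ n, ShiftInvariant (F n))
    (hG : ⋂ n, F n = G) (hGne : G.Nonempty) (hGinv : ShiftInvariant G) :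
    Tendsto (fun n => entropy (F n)) atTop (𝓝 (entropy G)) := by
  have hsub : ∀ n, G ⊆ F n := fun n => hG ▸ Set.iInter_subset F n
  -- by compactness, a word that occurs in every `F n` occurs in `G`
  have hwords : ∀ k, ∀ᶠ n in atTop, words (F n) k ⊆ words G k := by
    intro k
    have h1 : ∀ w : Word M k, ∀ᶠ n in atTop, w ∈ words (F n) k → w ∈ words G k := by
      intro w
      by_cases hw : ∀ n, w ∈ words (F n) k
      · refine Eventually.of_forall fun _ _ => ?_
        have hcl : ∀ n, IsClosed (F n ∩ {c | block c 0 k = w}) := fun n =>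
          (hclosed n).inter ((isClosed_discrete {w}).preimage (continuous_block 0 k))
        obtain ⟨c, hc⟩ := IsCompact.nonempty_iInter_of_sequence_nonempty_isCompact_isClosed
          (fun n => F n ∩ {c | block c 0 k = w})
          (fun n => Set.inter_subset_inter_left _ (hanti n.le_succ))
          (fun n => by obtain ⟨c, hc, hcw⟩ := hw n; exact ⟨c, hc, hcw⟩)
          (hcl 0).isCompact hcl
        rw [Set.mem_iInter] at hc
        exact ⟨c, hG ▸ Set.mem_iInter.2 fun n => (hc n).1, (hc 0).2⟩
      · push Not at hw
        obtain ⟨n, hn⟩ := hw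
        filter_upwards [eventually_ge_atTop n] with l hl h
        exact absurd (words_mono (hanti hl) k h) hn
    exact (eventually_all.2 h1).mono fun n hn w => hn w
  have hne : ∀ n, (F n).Nonempty := fun n => hGne.mono (hsub n)
  refine tendsto_order.2 ⟨fun a ha => Eventually.of_forall fun n =>
    ha.trans_le (entropy_mono hGne hGinv (hinv n) (hsub n)), fun a ha => ?_⟩
  obtain ⟨k, hk, hk0⟩ := (((entropyDefined hGne hGinv).2.eventually (gt_mem_nhds ha)).and
    (eventually_ne_atTop 0)).exists
  filter_upwards [hwords k] with n hn
  refine (entropy_le_entropyRate (hne n) (hinv n) hk0).trans_lt ?_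
  rwa [entropyRate, (hn.antisymm (words_mono (hsub n) k))]

/-! ### Counting words of symmetric lexicographic subshifts -/

/-- The sequences all of whose tails lie lexicographically between the reflection of `t` and `t`. -/
def symmShift (t : DigitSeq M) : Set (DigitSeq M) :=
  {c | ∀ m : ℕ, toLex (refl t) ≤ toLex (tail c m) ∧ toLex (tail c m) ≤ toLex t}

lemma shiftInvariant_symmShift (t : DigitSeq M) : ShiftInvariant (symmShift t) := by
  intro c hc m n
  rw [tail_tail]
  exact hc _

lemma refl_mem_symmShift {t c : DigitSeq M} (hc : c ∈ symmShift t) : refl c ∈ symmShift t := by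
  intro m
  rw [tail_refl]
  refine ⟨refl_le_refl.2 (hc m).2, ?_⟩
  rw [← refl_refl t]
  exact refl_le_refl.2 (hc m).1

lemma symmShift_mono {s t : DigitSeq M} (h : toLex s ≤ toLex t) : symmShift s ⊆ symmShift t :=
  fun _ hc m => ⟨(refl_le_refl.2 h).trans (hc m).1, (hc m).2.trans h⟩

lemma toLex_cons_lt_block_iff {k : ℕ} {a : Fin (M + 1)} {v : Word M k} {y : DigitSeq M} :
    toLex (Fin.cons a v : Word M (k + 1)) < toLex (block y 0 (k + 1)) ↔
      a < y 0 ∨ a = y 0 ∧ toLex v < toLex (block y 1 k) := by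
  have : block y 0 (k + 1) = (Fin.cons (y 0) (block y 1 k) : Word M (k + 1)) := by
    funext i
    refine Fin.cases ?_ (fun i => ?_) i
    · simp [block]
    · simp [block, add_comm]
  rw [this]
  exact Fin.pi_lex_lt_cons_cons (s := fun x y => x < y)

/-- The number of words of length `k` of `symmShift t`, as a real number. -/
noncomputable def numWords (t : DigitSeq M) (k : ℕ) : ℝ := ((words (symmShift t) k).ncard : ℝ)

/-- The number of words of length `k` of `symmShift t` that are smaller than the initial word
of `x`. -/
noncomputable def countBelow (t x : DigitSeq M) (k : ℕ) : ℕ :=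
  {w ∈ words (symmShift t) k | toLex w < toLex (block x 0 k)}.ncard

lemma ncard_setOf_tail_mem_words (t y : DigitSeq M) (k : ℕ) :
    {w : Word M (k + 1) | Fin.tail w ∈ words (symmShift t) k ∧
      toLex w < toLex (block y 0 (k + 1))}.ncard =
      (y 0 : ℕ) * (words (symmShift t) k).ncard + countBelow t (tail y 1) k := by
  have h1 : {w : Word M (k + 1) | Fin.tail w ∈ words (symmShift t) k ∧
      toLex w < toLex (block y 0 (k + 1))} =
      (fun p : Fin (M + 1) × Word M k => (Fin.cons p.1 p.2 : Word M (k + 1))) ''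
        ((Set.Iio (y 0) ×ˢ words (symmShift t) k) ∪ (({y 0} : Set (Fin (M + 1))) ×ˢ
          {v ∈ words (symmShift t) k | toLex v < toLex (block (tail y 1) 0 k)})) := by
    ext w
    rw [← Fin.cons_self_tail w]
    generalize Fin.tail w = v
    generalize w 0 = a
    rw [Set.mem_image]
    simp only [Set.mem_ofPred_eq, Fin.tail_cons, toLex_cons_lt_block_iff, block_tail, add_zero]
    constructor
    · rintro ⟨hv, h | ⟨h, h'⟩⟩
      · exact ⟨(a, v), Or.inl ⟨h, hv⟩, rfl⟩
      · exact ⟨(a, v), Or.inr ⟨h, hv, h'⟩, rfl⟩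
    · rintro ⟨⟨a', v'⟩, h, h'⟩
      obtain ⟨rfl, rfl⟩ := Fin.cons_injective2 h'
      rcases h with ⟨h1, h2⟩ | ⟨h1, h2, h3⟩
      · exact ⟨h2, Or.inl h1⟩
      · exact ⟨h2, Or.inr ⟨h1, h3⟩⟩
  have h2 : Function.Injective
      (fun p : Fin (M + 1) × Word M k => (Fin.cons p.1 p.2 : Word M (k + 1))) :=
    fun p p' h => Prod.ext (Fin.cons_injective2 h).1 (Fin.cons_injective2 h).2
  rw [h1, Set.ncard_image_of_injective _ h2, Set.ncard_union_eq, Set.ncard_prod, Set.ncard_prod,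
    Set.ncard_singleton, one_mul, countBelow]
  · congr 2
    rw [Set.ncard_eq_toFinset_card']
    simp
  · rw [Set.disjoint_left]
    rintro ⟨a, v⟩ ⟨h, -⟩ ⟨h', -⟩
    exact (ne_of_lt h) h'

/-- Prefixing a digit to a word of `symmShift t` gives a word of `symmShift t` as soon as the result
obeys the lexicographic bounds. -/
lemma mem_words_succ_iff {t : DigitSeq M} (ht : t ∈ symmShift t) {k : ℕ} {w : Word M (k + 1)} :
    w ∈ words (symmShift t) (k + 1) ↔ Fin.tail w ∈ words (symmShift t) k ∧
      toLex (block (refl t) 0 (k + 1)) ≤ toLex w ∧ toLex w ≤ toLex (block t 0 (k + 1)) := by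
  constructor
  · rintro ⟨c, hc, rfl⟩
    refine ⟨?_, ?_, ?_⟩
    · convert block_mem_words (shiftInvariant_symmShift t) hc 1 k using 1
      funext i
      simp [Fin.tail, block, add_comm]
    · have := (hc 0).1
      rw [tail_zero] at this
      exact le_iff_forall_block.1 this _
    · have := (hc 0).2
      rw [tail_zero] at this
      exact le_iff_forall_block.1 this _
  · rintro ⟨⟨d, hd, hdw⟩, h1, h2⟩
    rcases h1.lt_or_eq with h1 | h1
    swap
    · exact ⟨refl t, refl_mem_symmShift ht, toLex.injective h1⟩
    rcases h2.lt_or_eq with h2 | h2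
    swap
    · exact ⟨t, ht, (toLex.injective h2).symm⟩
    -- the word is strictly between the bounds, so any admissible continuation is allowed
    let c : DigitSeq M := fun n => Nat.casesOn n (w 0) d
    have hct : tail c 1 = d := by
      funext i
      simp [tail, c, add_comm]
    have hcw : block c 0 (k + 1) = w := by
      funext i
      refine Fin.cases ?_ (fun i => ?_) i
      · simp [block, c]
      · have := congrFun hdw i
        simpa [block, c, Fin.tail] using this
    refine ⟨c, fun m => ?_, hcw⟩
    rcases m with _ | m
    · rw [tail_zero]
      exact ⟨(lt_iff_exists_block.2 ⟨k + 1, by rwa [hcw]⟩).le,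
        (lt_iff_exists_block.2 ⟨k + 1, by rwa [hcw]⟩).le⟩
    · have : tail c (m + 1) = tail d m := by rw [← hct, tail_tail, add_comm]
      rw [this]
      exact hd m

/-- The words of length `k + 1` below `x` are the words `d v` below `x`, with `v` a word of length `k`,
except those below the lower bound `refl t`. -/
lemma countBelow_succ {t x : DigitSeq M} (ht : t ∈ symmShift t) (hx : x ∈ symmShift t) (k : ℕ) :
    countBelow t x (k + 1) + ((refl t 0 : ℕ) * (words (symmShift t) k).ncard +
      countBelow t (tail (refl t) 1) k) =
      (x 0 : ℕ) * (words (symmShift t) k).ncard + countBelow t (tail x 1) k := by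
  have hx0 := hx 0
  rw [tail_zero] at hx0
  have h1 := le_iff_forall_block.1 hx0.1 (k + 1)
  have h2 := le_iff_forall_block.1 hx0.2 (k + 1)
  rw [← ncard_setOf_tail_mem_words t x, ← ncard_setOf_tail_mem_words t (refl t), countBelow,
    ← Set.ncard_sdiff_add_ncard_of_subset (s := {w : Word M (k + 1) | Fin.tail w ∈
      words (symmShift t) k ∧ toLex w < toLex (block (refl t) 0 (k + 1))}) (t :=
      {w : Word M (k + 1) | Fin.tail w ∈ words (symmShift t) k ∧
        toLex w < toLex (block x 0 (k + 1))})]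
  · congr 2
    ext w
    simp only [Set.mem_ofPred_eq, Set.mem_sdiff, mem_words_succ_iff ht]
    constructor
    · rintro ⟨⟨h3, h4, h5⟩, h6⟩
      exact ⟨⟨h3, h6⟩, fun h => absurd h.2 (not_lt.2 h4)⟩
    · rintro ⟨⟨h3, h4⟩, h5⟩
      exact ⟨⟨h3, not_lt.1 fun h => h5 ⟨h3, h⟩, (h4.trans_le h2).le⟩, h4⟩
  · rintro w ⟨h3, h4⟩
    exact ⟨h3, h4.trans_le h1⟩

/-- The number of words below `x` is a linear function of the digits of `x`. -/
lemma countBelow_eq {t : DigitSeq M} (ht : t ∈ symmShift t) (k : ℕ) :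
    ∀ x ∈ symmShift t, (countBelow t x k : ℝ) = ∑ j ∈ Finset.range k,
      (((x j : ℕ) : ℝ) - ((refl t j : ℕ) : ℝ)) * numWords t (k - 1 - j) := by
  induction k with
  | zero =>
    intro x _
    simp only [Finset.range_zero, Finset.sum_empty, Nat.cast_eq_zero, countBelow]
    rw [Set.ncard_eq_zero, Set.eq_empty_iff_forall_notMem]
    rintro w ⟨-, j, -⟩
    exact j.elim0
  | succ k ih =>
    intro x hx
    have h1 := congrArg (Nat.cast : ℕ → ℝ) (countBelow_succ ht hx k)
    push_cast at h1
    rw [← numWords] at h1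
    rw [ih _ (shiftInvariant_symmShift t x hx 1),
      ih _ (shiftInvariant_symmShift t _ (refl_mem_symmShift ht) 1)] at h1
    rw [Finset.sum_range_succ']
    have h2 : ∀ j, numWords t (k - (j + 1)) = numWords t (k - 1 - j) := fun j => by
      rw [add_comm, Nat.sub_add_eq]
    simp only [h2, Nat.sub_zero, Nat.add_sub_cancel]
    have h3 : ∀ j, ((x (j + 1) : ℕ) : ℝ) - ((refl t (j + 1) : ℕ) : ℝ) =
        (((tail x 1 j : ℕ) : ℝ) - ((refl t j : ℕ) : ℝ)) -
          (((tail (refl t) 1 j : ℕ) : ℝ) - ((refl t j : ℕ) : ℝ)) := by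
      intro j; simp [tail, add_comm]
    simp only [h3, sub_mul _ (_ - _ : ℝ), Finset.sum_sub_distrib]
    linarith

/-- The renewal equation for the numbers of words of `symmShift t`. -/
lemma ncard_words_eq {t : DigitSeq M} (ht : t ∈ symmShift t) (k : ℕ) :
    numWords t k = 1 + ∑ j ∈ Finset.range k,
      (2 * ((t j : ℕ) : ℝ) - M) * numWords t (k - 1 - j) := by
  have h1 : (words (symmShift t) k).ncard = countBelow t t k + 1 := by
    rw [countBelow, ← Set.ncard_insert_of_notMem (a := block t 0 k)
      (fun h => lt_irrefl _ h.2)]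
    congr 1
    ext w
    simp only [Set.mem_insert_iff, Set.mem_ofPred_eq]
    constructor
    · rintro ⟨c, hc, rfl⟩
      have h2 := (hc 0).2
      rw [tail_zero] at h2
      rcases (le_iff_forall_block.1 h2 k).lt_or_eq with h | h
      · exact Or.inr ⟨⟨c, hc, rfl⟩, h⟩
      · exact Or.inl (toLex.injective h)
    · rintro (rfl | h)
      · exact ⟨t, ht, rfl⟩
      · exact h.1
  rw [numWords, h1, Nat.cast_add, countBelow_eq ht k t ht, add_comm, Nat.cast_one]
  congr 1
  refine Finset.sum_congr rfl fun j _ => ?_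
  congr 1
  have h3 : (t j : ℕ) ≤ M := Nat.lt_succ_iff.1 (t j).2
  simp only [refl, Fin.val_rev]
  rw [show M + 1 - ((t j : ℕ) + 1) = M - (t j : ℕ) by omega, Nat.cast_sub h3]
  ring

/-! ### Strict approximations from inside -/

/-- The sequences all of whose blocks of length `n` lie strictly between the initial blocks of the
reflection of `a` and of `a`. -/
def strictShift (a : DigitSeq M) (n : ℕ) : Set (DigitSeq M) :=
  {c | ∀ m : ℕ, toLex (block (refl a) 0 n) < toLex (block c m n) ∧
    toLex (block c m n) < toLex (block a 0 n)}

lemma strictShift_mono (a : DigitSeq M) : Monotone (strictShift a) :=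
  fun _ _ hn _ hc m => ⟨block_lt_mono hn (hc m).1, block_lt_mono hn (hc m).2⟩

lemma shiftInvariant_strictShift (a : DigitSeq M) (n : ℕ) : ShiftInvariant (strictShift a n) := by
  intro c hc m l
  rw [block_tail]
  exact hc _

lemma strictShift_subset (a : DigitSeq M) (n : ℕ) : strictShift a n ⊆ symmShift a := by
  intro c hc m
  refine ⟨(lt_iff_exists_block.2 ⟨n, ?_⟩).le, (lt_iff_exists_block.2 ⟨n, ?_⟩).le⟩
  · simpa using (hc m).1
  · simpa using (hc m).2

lemma refl_mem_strictShift {a c : DigitSeq M} {n : ℕ} (hc : c ∈ strictShift a n) :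
    refl c ∈ strictShift a n := by
  intro m
  refine ⟨block_refl_lt_block_refl.2 (hc m).2, ?_⟩
  rw [← refl_refl a]
  exact block_refl_lt_block_refl.2 (hc m).1

/-- A strict approximation is the symmetric lexicographic subshift of its largest element. -/
lemma strictShift_eq_symmShift {a t : DigitSeq M} {n : ℕ} (ht : t ∈ strictShift a n)
    (hmax : ∀ c ∈ strictShift a n, toLex c ≤ toLex t) : strictShift a n = symmShift t := by
  have hrefl : ∀ c ∈ strictShift a n, toLex (refl t) ≤ toLex c := fun c hc => by
    rw [← refl_refl c]
    exact refl_le_refl.2 (hmax _ (refl_mem_strictShift hc))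
  refine Set.Subset.antisymm (fun c hc m => ?_) (fun c hc m => ?_)
  · have := shiftInvariant_strictShift a n c hc m
    exact ⟨hrefl _ this, hmax _ this⟩
  · have h1 := le_iff_forall_block.1 (hc m).1 n
    have h2 := le_iff_forall_block.1 (hc m).2 n
    rw [block_tail, add_zero] at h1 h2
    exact ⟨((refl_mem_strictShift ht) 0).1.trans_le h1, h2.trans_lt (ht 0).2⟩

lemma exists_strictShift_eq {a : DigitSeq M} {n : ℕ} (hne : (strictShift a n).Nonempty) :
    ∃ t ∈ symmShift t, t ∈ strictShift a n ∧ strictShift a n = symmShift t ∧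
      ∀ c ∈ strictShift a n, toLex c ≤ toLex t := by
  obtain ⟨t, ht, hmax⟩ := exists_max_of_isClosed (isClosed_setOf_block
    fun w => toLex (block (refl a) 0 n) < toLex w ∧ toLex w < toLex (block a 0 n)) hne
  have h := strictShift_eq_symmShift ht hmax
  exact ⟨t, h ▸ ht, ht, h, hmax⟩

/-- If `a` itself violates the bounds it defines, then all admissible sequences stay away from
`a`. -/
lemma exists_symmShift_subset_strictShift {a : DigitSeq M} (ha : a ∉ symmShift a)
    (hclosed : IsClosed (symmShift a)) (hne : (symmShift a).Nonempty) :
    ∃ n, symmShift a ⊆ strictShift a n := by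
  obtain ⟨t, ht, hmax⟩ := exists_max_of_isClosed hclosed hne
  have hlt : toLex t < toLex a := by
    have h0 := (ht 0).2
    rw [tail_zero] at h0
    exact lt_of_le_of_ne h0 fun h => ha (toLex.injective h ▸ ht)
  obtain ⟨n, hn⟩ := lt_iff_exists_block.1 hlt
  have key : ∀ c ∈ symmShift a, ∀ m, toLex (block c m n) < toLex (block a 0 n) := by
    intro c hc m
    have h := le_iff_forall_block.1 (hmax _ (shiftInvariant_symmShift a c hc m)) n
    rw [block_tail, add_zero] at h
    exact h.trans_lt hn
  refine ⟨n, fun c hc m => ⟨?_, key c hc m⟩⟩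
  rw [← refl_refl c]
  exact block_refl_lt_block_refl.2 (key _ (refl_mem_symmShift hc) m)

lemma le_of_forall_lt_eq {c d : DigitSeq M} (h : toLex c ≤ toLex d) {j : ℕ}
    (hj : ∀ i < j, c i = d i) : c j ≤ d j := by
  by_contra hlt
  exact absurd (lex_lt_iff.2 ⟨j, fun i hi => (hj i hi).symm, not_le.1 hlt⟩) (not_lt.2 h)

/-- No proper suffix of the initial word of length `m` of `a` is the reflection of an initial
word of `a`. -/
def ReflFree (a : DigitSeq M) (m : ℕ) : Prop :=
  ∀ i, 0 < i → i < m → ∃ j, i + j < m ∧ a (i + j) ≠ (a j).rev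

lemma ReflFree.block_lt {a : DigitSeq M} {m : ℕ} (h : ReflFree a m) (ha : a ∈ symmShift a) {i : ℕ}
    (hi : 0 < i) (him : i < m) :
    toLex (block (refl a) 0 (m - i)) < toLex (block a i (m - i)) := by
  refine lt_of_le_of_ne ?_ fun heq => ?_
  · have := le_iff_forall_block.1 (ha i).1 (m - i)
    rwa [block_tail, add_zero] at this
  · obtain ⟨j, hj, hne⟩ := h i hi him
    refine hne ?_
    have := block_eq_iff.1 (toLex.injective heq) j (by omega)
    rw [zero_add] at this
    exact this.symm

/-- The periodic sequence whose period is the initial word of length `m` of `a` with the last digit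
decreased by one. -/
def decPeriodic (a : DigitSeq M) (m : ℕ) : DigitSeq M := fun n =>
  if n % m = m - 1 then ⟨(a (m - 1) : ℕ) - 1, by omega⟩ else a (n % m)

lemma decPeriodic_of_lt {a : DigitSeq M} {m j : ℕ} (s : ℕ) (hj : j + 1 < m) :
    decPeriodic a m (m * s + j) = a j := by
  have h1 : (m * s + j) % m = j := by rw [Nat.mul_add_mod, Nat.mod_eq_of_lt (by omega)]
  rw [decPeriodic, h1, if_neg (by omega)]

lemma decPeriodic_last {a : DigitSeq M} {m j : ℕ} (s : ℕ) (hj : j + 1 = m) :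
    (decPeriodic a m (m * s + j) : ℕ) = (a j : ℕ) - 1 := by
  have h1 : (m * s + j) % m = j := by rw [Nat.mul_add_mod, Nat.mod_eq_of_lt (by omega)]
  rw [decPeriodic, h1, if_pos (by omega)]
  subst hj
  rfl

lemma ReflFree.pos_last {a : DigitSeq M} {m : ℕ} (h : ReflFree a m) (ha : a ∈ symmShift a)
    (hm : 1 ≤ m) (h0 : M < 2 * (a 0 : ℕ)) : 0 < (a (m - 1) : ℕ) := by
  rcases hm.eq_or_lt with rfl | hm
  · simp only [Nat.sub_self]; omega
  · have h1 := h.block_lt ha (i := m - 1) (by omega) (by omega)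
    obtain ⟨j, hj, -, h2⟩ := block_lt_iff.1 h1
    obtain rfl : j = 0 := by omega
    exact (Nat.zero_le _).trans_lt (show (refl a (0 + 0) : ℕ) < (a (m - 1 + 0) : ℕ) from h2)

/-- The upper bounds hold since the last digit of each suffix was lowered. For the lower bounds, a
suffix of `a_1 ⋯ a_m` is larger than the reflected prefix of its length, so after the decrease it is
at least that prefix; in case of equality the comparison continues with a prefix of `a` on one side
and a reflected suffix on the other, to which the hypothesis applies again. For `m = 1` there is no
proper suffix, and the digit `a_1 - 1` itself has to exceed its reflection. -/
lemma decPeriodic_mem_strictShift {a : DigitSeq M} {m : ℕ} (h : ReflFree a m)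
    (ha : a ∈ symmShift a) (hm : 1 ≤ m) (h0 : M < 2 * (a 0 : ℕ))
    (h1 : m = 1 → M + 1 < 2 * (a 0 : ℕ)) : decPeriodic a m ∈ strictShift a m := by
  have hpos := h.pos_last ha hm h0
  have hrev : ∀ j, ((a j).rev : ℕ) = M - (a j : ℕ) := fun j => by rw [Fin.val_rev]; omega
  intro l
  obtain ⟨s, i, hi, rfl⟩ : ∃ s i, i < m ∧ l = m * s + i :=
    ⟨l / m, l % m, Nat.mod_lt _ hm, (Nat.div_add_mod l m).symm⟩
  have hdec : ∀ j, i + j + 1 < m → decPeriodic a m (m * s + i + j) = a (i + j) := fun j hj => by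
    rw [add_assoc]; exact decPeriodic_of_lt s hj
  have hlast : (decPeriodic a m (m * s + i + (m - i - 1)) : ℕ) = (a (m - 1) : ℕ) - 1 := by
    rw [add_assoc, decPeriodic_last s (by omega)]
    congr 3; omega
  refine ⟨?_, ?_⟩
  · rcases Nat.eq_zero_or_pos i with rfl | hi0
    · rw [block_lt_iff]
      refine ⟨0, hm, fun i hi => absurd hi (Nat.not_lt_zero i), Fin.lt_def.2 ?_⟩
      simp only [refl, add_zero, hrev]
      rcases hm.eq_or_lt with rfl | hm
      · have := decPeriodic_last (a := a) (m := 1) (j := 0) s rfl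
        rw [add_zero] at this
        rw [this]
        have := h1 rfl
        omega
      · have := decPeriodic_of_lt (a := a) (j := 0) s hm
        rw [add_zero] at this
        rw [this]
        omega
    · obtain ⟨j, hj, hjlt, hjj⟩ := block_lt_iff.1 (h.block_lt ha hi0 hi)
      simp only [zero_add] at hjlt hjj
      by_cases hjm : i + j + 1 < m
      · rw [block_lt_iff]
        refine ⟨j, by omega, fun k hk => ?_, ?_⟩
        · rw [zero_add, hjlt k hk, hdec k (by omega)]
        · rwa [zero_add, hdec j hjm]
      · obtain rfl : j = m - i - 1 := by omega
        have hji : i + (m - i - 1) = m - 1 := by omega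
        rw [hji] at hjj
        rcases (Nat.le_sub_one_of_lt (Fin.lt_def.1 hjj)).lt_or_eq with hlt | heq
        · rw [block_lt_iff]
          refine ⟨m - i - 1, by omega, fun k hk => ?_, ?_⟩
          · rw [zero_add, hjlt k hk, hdec k (by omega)]
          · rw [zero_add, Fin.lt_def, hlast]
            exact hlt
        · -- the decreased suffix is a reflected prefix; the next digits decide
          have h2 := h.block_lt ha (i := m - i) (by omega) (by omega)
          rw [show m - (m - i) = i by omega] at h2
          have h3 : toLex (block (refl a) (m - i) i) < toLex (block (refl (refl a)) 0 i) :=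
            block_refl_lt_block_refl.2 h2
          rw [refl_refl] at h3
          obtain ⟨k, hk, hklt, hkk⟩ := block_lt_iff.1 h3
          simp only [zero_add] at hklt hkk
          have hnext : ∀ k < i, decPeriodic a m (m * s + i + (m - i + k)) = a k := fun k hk => by
            rw [show m * s + i + (m - i + k) = m * (s + 1) + k by
              rw [Nat.mul_succ]; omega]
            exact decPeriodic_of_lt _ (by omega)
          rw [block_lt_iff]
          refine ⟨m - i + k, by omega, fun r hr => ?_, ?_⟩
          · rw [zero_add]
            rcases lt_trichotomy r (m - i - 1) with hr1 | rfl | hr1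
            · rw [hjlt r hr1, hdec r (by omega)]
            · exact Fin.ext (heq.trans hlast.symm)
            · obtain ⟨u, rfl⟩ : ∃ u, r = m - i + u := ⟨r - (m - i), by omega⟩
              rw [hnext u (by omega), hklt u (by omega)]
          · rw [zero_add, hnext k hk]
            exact hkk
  · refine block_lt_mono (n := m - i) (by omega)
      (lt_of_lt_of_le ?_ ?_ (b := toLex (block a i (m - i))))
    · refine block_lt_iff.2 ⟨m - i - 1, by omega, fun k hk => hdec k (by omega), ?_⟩
      rw [Fin.lt_def, hlast, show i + (m - i - 1) = m - 1 by omega]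
      omega
    · have := le_iff_forall_block.1 (ha i).2 (m - i)
      rwa [block_tail, add_zero] at this

/-- The lowered word is the immediate predecessor of the initial word of `a`, so its periodic
repetition is an upper bound. -/
lemma le_decPeriodic {a c : DigitSeq M} {m : ℕ} (hm : 1 ≤ m) (hc : c ∈ strictShift a m) :
    toLex c ≤ toLex (decPeriodic a m) := by
  by_contra hlt
  obtain ⟨n, h1, h2⟩ := lex_lt_iff.1 (not_le.1 hlt)
  obtain ⟨s, i, hi, rfl⟩ : ∃ s i, i < m ∧ n = m * s + i :=
    ⟨n / m, n % m, Nat.mod_lt _ hm, (Nat.div_add_mod n m).symm⟩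
  obtain ⟨j, hj, hjlt, hjj⟩ := block_lt_iff.1 (hc (m * s)).2
  simp only [zero_add] at hjlt hjj
  have hdec : ∀ k < i, a k = c (m * s + k) := fun k hk => by
    rw [← h1 _ (by omega)]
    exact (decPeriodic_of_lt s (by omega)).symm
  have hij : i ≤ j := by
    by_contra hji
    exact (ne_of_lt hjj) (hdec j (by omega)).symm
  rcases Nat.lt_or_ge (i + 1) m with him | him
  · rw [decPeriodic_of_lt s him] at h2
    rcases hij.eq_or_lt with rfl | hij
    · exact lt_asymm h2 hjj
    · exact (ne_of_lt h2) (hjlt i hij).symm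
  · obtain rfl : i = j := by omega
    have h3 := Fin.lt_def.1 h2
    rw [decPeriodic_last s (by omega)] at h3
    have h4 := Fin.lt_def.1 hjj
    omega

/-- If only finitely many initial words of `a` are free of reflected suffixes, then `a` is of the
form `w w̄ w w̄ ⋯`, where `w` is the longest of these words. -/
lemma add_eq_rev_of_last_reflFree {a : DigitSeq M} (ha : a ∈ symmShift a) {N : ℕ}
    (hN : ReflFree a N) (hlast : ∀ n, N < n → ¬ ReflFree a n) (hN0 : 0 < N) (j : ℕ) :
    a (N + j) = (a j).rev := by
  induction j using Nat.strong_induction_on with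
  | _ j ih =>
    have h1 := hlast (N + j + 1) (by omega)
    unfold ReflFree at h1
    push Not at h1
    obtain ⟨i, hi0, hi, hmatch⟩ := h1
    rcases lt_trichotomy i N with hiN | rfl | hiN
    · obtain ⟨l, hl, hne⟩ := hN i hi0 hiN
      exact absurd (hmatch l (by omega)) hne
    · exact hmatch j (by omega)
    · -- a later match cannot beat the match at `N`, as `a` dominates its tails
      have h2 : (a j).rev ≤ a (N + j) :=
        le_of_forall_lt_eq (ha N).1 (fun k hk => (ih k hk).symm)
      have h3 := hmatch (N + j - i) (by omega)
      rw [show i + (N + j - i) = N + j by omega] at h3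
      have h4 : a (i - N + (N + j - i)) ≤ a (N + j - i) :=
        le_of_forall_lt_eq (ha (i - N)).2 (fun k hk => by
          have h5 := hmatch k (by omega)
          have h6 := ih (i - N + k) (by omega)
          rw [show N + (i - N + k) = i + k by omega, h5, Fin.rev_inj] at h6
          exact h6.symm)
      rw [show i - N + (N + j - i) = j by omega] at h4
      refine le_antisymm ?_ h2
      rw [h3]
      exact Fin.rev_le_rev.2 h4

/-! ### Sequences of the form `w w̄ w w̄ ⋯` -/

open PowerSeries in
/-- The renewal equation as an identity between generating functions. -/
lemma mk_numWords_mul {t : DigitSeq M} (ht : t ∈ symmShift t) :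
    PowerSeries.mk (numWords t) * (1 - X) *
      (1 - X * PowerSeries.mk fun j => 2 * ((t j : ℕ) : ℝ) - M) = 1 := by
  have h1 : PowerSeries.mk (numWords t) = PowerSeries.mk 1 +
      X * ((PowerSeries.mk fun j => 2 * ((t j : ℕ) : ℝ) - M) * PowerSeries.mk (numWords t)) := by
    ext k
    rcases k with _ | k
    · rw [map_add, coeff_zero_X_mul, coeff_mk, coeff_mk, ncard_words_eq ht 0,
        Finset.sum_range_zero]
      rfl
    · rw [map_add, coeff_succ_X_mul, coeff_mul, Finset.Nat.sum_antidiagonal_eq_sum_range_succ_mk,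
        coeff_mk, coeff_mk, ncard_words_eq ht (k + 1)]
      simp
  have h2 : (PowerSeries.mk 1 : PowerSeries ℝ) * (1 - X) = 1 := mk_one_mul_one_sub_eq_one ℝ
  linear_combination (1 - X) * h1 + h2

lemma numWords_mono {t : DigitSeq M} {m n : ℕ} (h : m ≤ n) : numWords t m ≤ numWords t n := by
  unfold numWords
  exact_mod_cast ncard_words_mono_length _ h

open PowerSeries in
/-- For `a = w w̄ w w̄ ⋯` and the periodic sequence obtained from `w` by lowering its last digit, the
counts satisfy `A k - A (k - N) = B k + B (k - N)`. -/
lemma numWords_le_of_add_eq_rev {a : DigitSeq M} {N : ℕ} (hN : 1 ≤ N) (ha : a ∈ symmShift a)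
    (ht : decPeriodic a N ∈ symmShift (decPeriodic a N)) (hpos : 0 < (a (N - 1) : ℕ))
    (hrev : ∀ j, a (N + j) = (a j).rev) (k : ℕ) :
    numWords a k ≤ (2 * k + 1) * numWords (decPeriodic a N) k := by
  set t := decPeriodic a N with ht'
  have hA := mk_numWords_mul ha
  have hB := mk_numWords_mul ht
  -- the two characteristic series agree up to the factors `1 ± X ^ N`
  have hR : (1 - X * PowerSeries.mk fun j => 2 * ((a j : ℕ) : ℝ) - M) * (1 + X ^ N) =
      (1 - X * PowerSeries.mk fun j => 2 * ((t j : ℕ) : ℝ) - M) * (1 - X ^ N) := by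
    have hR' : X ^ N * (PowerSeries.mk (fun j => 2 * ((a j : ℕ) : ℝ) - M) +
        PowerSeries.mk fun j => 2 * ((t j : ℕ) : ℝ) - M) =
        C (2 : ℝ) * X ^ (N - 1) - (PowerSeries.mk fun j => 2 * ((a j : ℕ) : ℝ) - M) +
          PowerSeries.mk fun j => 2 * ((t j : ℕ) : ℝ) - M := by
      ext n
      rw [coeff_X_pow_mul', map_add, map_add, map_sub, coeff_C_mul, coeff_X_pow]
      split_ifs with h1 h2 h2
      · omega
      · obtain ⟨j, rfl⟩ := Nat.exists_eq_add_of_le h1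
        have h3 : t (N + j) = t j := by
          simp only [ht', decPeriodic, Nat.add_mod_left]
        have h4 : ((a (N + j) : ℕ) : ℝ) = M - ((a j : ℕ) : ℝ) := by
          have := Nat.lt_succ_iff.1 (a j).2
          rw [hrev, Fin.val_rev, show M + 1 - ((a j : ℕ) + 1) = M - (a j : ℕ) by omega,
            Nat.cast_sub this]
        rw [coeff_mk, coeff_mk, coeff_mk, coeff_mk, Nat.add_sub_cancel_left, h3, h4]
        ring
      · subst h2
        have h3 := decPeriodic_last (a := a) (m := N) (j := N - 1) 0 (by omega)
        rw [mul_zero, zero_add] at h3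
        rw [coeff_mk, coeff_mk, ht', h3, Nat.cast_sub hpos]
        push_cast
        ring
      · have h3 := decPeriodic_of_lt (a := a) (m := N) (j := n) 0 (by omega)
        rw [mul_zero, zero_add] at h3
        rw [coeff_mk, coeff_mk, ht', h3]
        ring
    have hX : (X : PowerSeries ℝ) ^ N = X * X ^ (N - 1) := by
      rw [← pow_succ', Nat.sub_add_cancel hN]
    have hC : (C (2 : ℝ) : PowerSeries ℝ) = 2 := map_ofNat C 2
    rw [hC] at hR'
    linear_combination (-X) * hR' + 2 * hX
  have hAB : PowerSeries.mk (numWords a) * (1 - X ^ N) =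
      PowerSeries.mk (numWords t) * (1 + X ^ N) := by
    linear_combination (-PowerSeries.mk (numWords a) * (1 - X ^ N)) * hB +
      PowerSeries.mk (numWords t) * (1 + X ^ N) * hA -
      PowerSeries.mk (numWords a) * PowerSeries.mk (numWords t) * (1 - X) * hR
  have hcoeff : ∀ n, numWords a n - (if N ≤ n then numWords a (n - N) else 0) =
      numWords t n + if N ≤ n then numWords t (n - N) else 0 := by
    intro n
    have := congrArg (coeff n) hAB
    rw [mul_sub, mul_add, mul_one, mul_one, map_sub, map_add, coeff_mul_X_pow', coeff_mul_X_pow',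
      coeff_mk, coeff_mk, coeff_mk, coeff_mk] at this
    exact this
  induction k using Nat.strong_induction_on with
  | _ k ih =>
    have h1 := hcoeff k
    have h0 : 0 ≤ numWords t k := Nat.cast_nonneg _
    split_ifs at h1 with h
    · have h2 := ih (k - N) (by omega)
      have h3 : numWords t (k - N) ≤ numWords t k := numWords_mono (by omega)
      have h4 : ((k - N : ℕ) : ℝ) + 1 ≤ k := by
        have : k - N + 1 ≤ k := by omega
        exact_mod_cast this
      have h5 : 0 ≤ numWords t (k - N) := Nat.cast_nonneg _
      have h6 : (2 * ((k - N : ℕ) : ℝ) + 1) * numWords t (k - N) ≤ (2 * k - 1) * numWords t k := by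
        apply mul_le_mul (by linarith) h3 h5
        have : (0 : ℝ) ≤ ((k - N : ℕ) : ℝ) := Nat.cast_nonneg _
        linarith
      linarith
    · have : (0 : ℝ) ≤ 2 * k * numWords t k := by positivity
      linarith

/-! ### Approximation of the entropy from inside -/

/-- The series `ρ` for which `1 / ((1 - z) (1 - ρ z))` is the generating function of the word counts of
`symmShift t`, for admissible `t`. Digits are indexed from `0`, whence the exponent `j + 1`. -/
noncomputable def charSeries (t : DigitSeq M) (z : ℝ) : ℝ :=
  ∑' j : ℕ, (2 * ((t j : ℕ) : ℝ) - M) * z ^ (j + 1)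

lemma abs_two_mul_sub_le (t : DigitSeq M) (j : ℕ) : |2 * ((t j : ℕ) : ℝ) - M| ≤ M := by
  have h1 := digit_le t j
  have h2 : (0 : ℝ) ≤ ((t j : ℕ) : ℝ) := Nat.cast_nonneg _
  rw [abs_le]
  constructor <;> linarith

lemma summable_geom_bound (M : ℕ) {z : ℝ} (h0 : 0 ≤ z) (h1 : z < 1) :
    Summable fun j : ℕ => (M : ℝ) * z ^ (j + 1) :=
  ((summable_nat_add_iff 1).2 (summable_geometric_of_lt_one h0 h1)).mul_left _

lemma norm_charSeries_term_le (t : DigitSeq M) {z : ℝ} (h0 : 0 ≤ z) (j : ℕ) :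
    ‖(2 * ((t j : ℕ) : ℝ) - M) * z ^ (j + 1)‖ ≤ M * z ^ (j + 1) := by
  rw [norm_mul, norm_pow, Real.norm_of_nonneg h0]
  exact mul_le_mul_of_nonneg_right (abs_two_mul_sub_le t j) (by positivity)

/-- By the identity theorem, as `charSeries t` vanishes at `0`. -/
lemma exists_charSeries_ne_one (t : DigitSeq M) {u v : ℝ} (hu : 0 ≤ u) (huv : u < v) (hv : v ≤ 1) :
    ∃ z, u < z ∧ z < v ∧ charSeries t z ≠ 1 := by
  by_contra! hcon
  obtain ⟨x, hux, hxv⟩ := exists_between huv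
  obtain ⟨R, hxR, hRv⟩ := exists_between hxv
  have hR0 : 0 < R := by linarith
  let F : ℂ → ℂ := fun w => ∑' j : ℕ, (2 * ((t j : ℕ) : ℂ) - M) * w ^ (j + 1)
  have hdiff : DifferentiableOn ℂ F (Metric.ball 0 R) := by
    refine Complex.differentiableOn_tsum_of_summable_norm
      (summable_geom_bound M hR0.le (hRv.trans_le hv)) (fun j => ?_) Metric.isOpen_ball
      (fun j w hw => ?_)
    · fun_prop
    · have hw' : ‖w‖ ≤ R := by
        rw [Metric.mem_ball, dist_zero_right] at hw
        exact hw.le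
      rw [norm_mul, norm_pow]
      have h1 : ‖(2 * ((t j : ℕ) : ℂ) - M)‖ ≤ M := by
        have h2 := abs_two_mul_sub_le t j
        rw [← Real.norm_eq_abs, ← Complex.norm_real] at h2
        simpa using h2
      gcongr
  have hF : ∀ y : ℝ, F y = (charSeries t y : ℂ) := by
    intro y
    simp only [F, charSeries, Complex.ofReal_tsum]
    refine tsum_congr fun j => ?_
    push_cast
    rfl
  have hlim : Tendsto (fun y : ℝ => (y : ℂ)) (𝓝[≠] x) (𝓝[≠] (x : ℂ)) := by
    refine tendsto_nhdsWithin_of_tendsto_nhds_of_eventually_within _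
      (Complex.continuous_ofReal.continuousAt.tendsto.mono_left nhdsWithin_le_nhds) ?_
    filter_upwards [self_mem_nhdsWithin] with y hy
    simpa using hy
  have hfreq : ∃ᶠ w in 𝓝[≠] (x : ℂ), F w = (fun _ => 1) w := by
    refine hlim.frequently (Eventually.frequently ?_)
    filter_upwards [nhdsWithin_le_nhds (Ioo_mem_nhds hux hxR)] with y hy
    rw [hF, hcon y hy.1 (hy.2.trans hRv), Complex.ofReal_one]
  have h0 := (hdiff.analyticOnNhd Metric.isOpen_ball).eqOn_of_preconnected_of_frequently_eq
    analyticOnNhd_const (convex_ball (0 : ℂ) R).isPreconnected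
    (by simpa [abs_of_pos (hu.trans_lt hux)] using hxR) hfreq
    (Metric.mem_ball_self hR0)
  simp [F] at h0

/-- The renewal equation, evaluated inside the disc of convergence. -/
lemma tsum_numWords_mul {t : DigitSeq M} (ht : t ∈ symmShift t) {z : ℝ} (h0 : 0 ≤ z) (h1 : z < 1)
    (hs : Summable fun k => numWords t k * z ^ k) :
    (∑' k, numWords t k * z ^ k) * (1 - charSeries t z) = (1 - z)⁻¹ := by
  have hρ : Summable fun j : ℕ => ‖(2 * ((t j : ℕ) : ℝ) - M) * z ^ (j + 1)‖ :=
    Summable.of_nonneg_of_le (fun _ => norm_nonneg _) (norm_charSeries_term_le t h0)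
      (summable_geom_bound M h0 h1)
  have hprod := tsum_mul_tsum_eq_tsum_sum_range_of_summable_norm hρ hs.norm
  have hterm : ∀ n, ∑ j ∈ Finset.range (n + 1), (2 * ((t j : ℕ) : ℝ) - M) * z ^ (j + 1) *
      (numWords t (n - j) * z ^ (n - j)) = numWords t (n + 1) * z ^ (n + 1) - z ^ (n + 1) := by
    intro n
    rw [ncard_words_eq ht (n + 1), add_mul, one_mul, add_sub_cancel_left, Finset.sum_mul]
    refine Finset.sum_congr rfl fun j hj => ?_
    have hj' := Finset.mem_range_succ_iff.1 hj
    have hpow : z ^ (n + 1) = z ^ (j + 1) * z ^ (n - j) := by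
      rw [← pow_add]; congr 1; omega
    rw [hpow, Nat.add_sub_cancel]
    ring
  simp only [hterm] at hprod
  have hs' := (summable_nat_add_iff 1).2 hs
  have hg := summable_geometric_of_lt_one h0 h1
  have hg' := (summable_nat_add_iff 1).2 hg
  rw [hs'.tsum_sub hg'] at hprod
  have h2 := hs.tsum_eq_zero_add
  have h3 := hg.tsum_eq_zero_add
  rw [tsum_geometric_of_lt_one h0 h1] at h3
  have h4 : numWords t 0 = 1 := by rw [ncard_words_eq ht 0]; simp
  rw [h4] at h2
  rw [charSeries]
  linear_combination h2 - hprod - h3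

/-- By the renewal equation the word counts up to length `k` depend on the first `k` digits only. -/
lemma numWords_congr {s t : DigitSeq M} (hs : s ∈ symmShift s) (ht : t ∈ symmShift t) (k : ℕ)
    (h : ∀ j < k, s j = t j) : numWords s k = numWords t k := by
  induction k using Nat.strong_induction_on with
  | _ k ih =>
    rw [ncard_words_eq hs, ncard_words_eq ht]
    congr 1
    refine Finset.sum_congr rfl fun j hj => ?_
    have hj' := Finset.mem_range.1 hj
    rw [h j hj', ih (k - 1 - j) (by omega) fun i hi => h i (by omega)]

lemma tendsto_charSeries {t : ℕ → DigitSeq M} {a : DigitSeq M}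
    (h : ∀ j, ∀ᶠ n in atTop, t n j = a j) {z : ℝ} (h0 : 0 ≤ z) (h1 : z < 1) :
    Tendsto (fun n => charSeries (t n) z) atTop (𝓝 (charSeries a z)) := by
  refine tendsto_tsum_of_dominated_convergence (summable_geom_bound M h0 h1) (fun j => ?_)
    (Eventually.of_forall fun n j => norm_charSeries_term_le (t n) h0 j)
  refine Tendsto.congr' ?_ tendsto_const_nhds
  filter_upwards [h j] with n hn
  rw [hn]

lemma summable_numWords {t : DigitSeq M} (ht : t ∈ symmShift t) {z : ℝ} (h0 : 0 < z)
    (h : entropy (symmShift t) < -Real.logb 2 z) : Summable fun k => numWords t k * z ^ k := by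
  obtain ⟨r, hr1, hr2⟩ := exists_between h
  have hne : (symmShift t).Nonempty := ⟨t, ht⟩
  have hrz : (2 : ℝ) ^ r * z < 1 := by
    calc (2 : ℝ) ^ r * z < 2 ^ (-Real.logb 2 z) * z := by
          exact mul_lt_mul_of_pos_right (Real.rpow_lt_rpow_of_exponent_lt (by norm_num) hr2) h0
      _ = 1 := by
          rw [Real.rpow_neg (by norm_num), Real.rpow_logb (by norm_num) (by norm_num) h0,
            inv_mul_cancel₀ h0.ne']
  refine Summable.of_norm_bounded_eventually_nat
    (summable_geometric_of_lt_one (by positivity) hrz) ?_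
  filter_upwards [(entropyDefined hne (shiftInvariant_symmShift t)).2.eventually (gt_mem_nhds hr1),
    eventually_gt_atTop 0] with k hk hk0
  have hk0' : (0 : ℝ) < k := by exact_mod_cast hk0
  have h1 : (0 : ℝ) < numWords t k := by
    have := one_le_ncard_words hne k
    unfold numWords
    exact_mod_cast this
  rw [Real.norm_of_nonneg (by positivity), mul_pow]
  gcongr
  rw [entropyRate, div_lt_iff₀ hk0', ← numWords, Real.logb_lt_iff_lt_rpow (by norm_num) h1,
    Real.rpow_mul (by norm_num), Real.rpow_natCast] at hk
  exact hk.le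

lemma rpow_entropy_le_numWords {t : DigitSeq M} (ht : t ∈ symmShift t) {k : ℕ} (hk : k ≠ 0) :
    ((2 : ℝ) ^ entropy (symmShift t)) ^ k ≤ numWords t k := by
  have hne : (symmShift t).Nonempty := ⟨t, ht⟩
  have h := entropy_le_entropyRate hne (shiftInvariant_symmShift t) hk
  have hk0' : (0 : ℝ) < k := by exact_mod_cast Nat.pos_of_ne_zero hk
  have h1 : (0 : ℝ) < numWords t k := by
    have := one_le_ncard_words hne k
    unfold numWords
    exact_mod_cast this
  rw [entropyRate, le_div_iff₀ hk0', ← numWords, Real.le_logb_iff_rpow_le (by norm_num) h1,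
    Real.rpow_mul (by norm_num), Real.rpow_natCast] at h
  exact h

/-- If the admissible sequences `t n` converge to `a`, then the entropy of `symmShift (t n)` cannot
stay away from that of `symmShift a`: otherwise the generating functions of the word counts would
be bounded at a point where that of `a` diverges. -/
lemma exists_lt_entropy_of_tendsto {t : ℕ → DigitSeq M} {a : DigitSeq M}
    (ht : ∀ n, t n ∈ symmShift (t n)) (ha : a ∈ symmShift a)
    (h : ∀ j, ∀ᶠ n in atTop, ∀ i < j, t n i = a i) {r : ℝ} (hr0 : 0 ≤ r)
    (hr : r < entropy (symmShift a)) : ∃ n, r < entropy (symmShift (t n)) := by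
  by_contra! hcon
  have h2 : (1 : ℝ) < 2 := by norm_num
  have huv : (2 : ℝ) ^ (-entropy (symmShift a)) < 2 ^ (-r) :=
    Real.rpow_lt_rpow_of_exponent_lt h2 (by linarith)
  -- `z` lies beyond the radius of convergence for `a` and inside those for all `t n`
  obtain ⟨z, hz1, hz2, hz⟩ := exists_charSeries_ne_one a (by positivity) huv
    (Real.rpow_le_one_of_one_le_of_nonpos h2.le (by linarith))
  have hz0 : 0 < z := lt_of_le_of_lt (by positivity) hz1
  have hz1' : z < 1 := hz2.trans_le (Real.rpow_le_one_of_one_le_of_nonpos h2.le (by linarith))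
  have hs : ∀ n, Summable fun k => numWords (t n) k * z ^ k := fun n => by
    refine summable_numWords (ht n) hz0 ((hcon n).trans_lt ?_)
    rw [lt_neg, Real.logb_lt_iff_lt_rpow h2 hz0]
    exact hz2
  have hlim := tendsto_charSeries (fun j => (h (j + 1)).mono fun n hn => hn j (Nat.lt_succ_self j))
    hz0.le hz1'
  have hlim' : Tendsto (fun n => (1 - z)⁻¹ / (1 - charSeries (t n) z)) atTop
      (𝓝 ((1 - z)⁻¹ / (1 - charSeries a z))) :=
    tendsto_const_nhds.div (tendsto_const_nhds.sub hlim) (sub_ne_zero.2 hz.symm)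
  set L := (1 - z)⁻¹ / (1 - charSeries a z)
  have hbound : ∀ k, numWords a k * z ^ k ≤ L + 1 := by
    intro k
    obtain ⟨n, hn1, hn2⟩ :=
      ((hlim'.eventually (gt_mem_nhds (lt_add_one L))).and (h k)).exists
    have h3 := tsum_numWords_mul (ht n) hz0.le hz1' (hs n)
    have h4 : 1 - charSeries (t n) z ≠ 0 := by
      intro h0
      rw [h0, mul_zero] at h3
      exact (inv_pos.2 (sub_pos.2 hz1')).ne h3
    rw [← h3, mul_div_cancel_right₀ _ h4] at hn1
    rw [← numWords_congr (ht n) ha k hn2]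
    refine le_trans ?_ hn1.le
    exact (hs n).le_tsum k fun j _ => mul_nonneg (Nat.cast_nonneg _) (by positivity)
  have hbig : 1 < (2 : ℝ) ^ entropy (symmShift a) * z := by
    rw [Real.rpow_neg (by norm_num), inv_lt_iff_one_lt_mul₀' (by positivity)] at hz1
    exact hz1
  obtain ⟨k, hk, hk0⟩ := (((tendsto_pow_atTop_atTop_of_one_lt hbig).eventually_gt_atTop
    (L + 1)).and (eventually_ne_atTop 0)).exists
  refine absurd (hbound k) (not_le.2 (hk.trans_le ?_))
  rw [mul_pow]
  gcongr
  exact rpow_entropy_le_numWords ha hk0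

/-- The strict approximations exhaust the entropy of `symmShift a`. -/
lemma exists_lt_entropy_strictShift {a : DigitSeq M} {n₀ : ℕ}
    (hclosed : IsClosed (symmShift a)) (hne : (strictShift a n₀).Nonempty)
    (h0 : M < 2 * (a 0 : ℕ)) (h1 : (∀ j, a (1 + j) = (a j).rev) → M + 1 < 2 * (a 0 : ℕ))
    {r : ℝ} (hr : r < entropy (symmShift a)) :
    ∃ n, n₀ ≤ n ∧ r < entropy (strictShift a n) := by
  have hinv := shiftInvariant_strictShift a
  have hneN : ∀ n, n₀ ≤ n → (strictShift a n).Nonempty := fun n hn =>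
    hne.mono (strictShift_mono a hn)
  by_cases ha : a ∈ symmShift a
  swap
  · obtain ⟨n, hn⟩ := exists_symmShift_subset_strictShift ha hclosed
      (hne.mono (strictShift_subset a n₀))
    refine ⟨max n₀ n, le_max_left _ _, hr.trans_le ?_⟩
    exact entropy_mono (hne.mono (strictShift_subset a n₀)) (shiftInvariant_symmShift a) (hinv _)
      (hn.trans (strictShift_mono a (le_max_right _ _)))
  by_cases hfin : ∀ N, ∃ m, N < m ∧ ReflFree a m
  · rcases lt_or_ge r 0 with hr0 | hr0
    · exact ⟨n₀, le_rfl, hr0.trans_le (entropy_nonneg hne (hinv _))⟩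
    choose t ht1 ht2 ht3 ht4 using fun n => exists_strictShift_eq (hneN (n₀ + n) (by omega))
    have hconv : ∀ j, ∀ᶠ n in atTop, ∀ i < j, t n i = a i := by
      intro j
      obtain ⟨m, hm, hmfree⟩ := hfin (j + 1)
      have hp := decPeriodic_mem_strictShift hmfree ha (by omega) h0 (by omega)
      filter_upwards [eventually_ge_atTop m] with n hn i hi
      have h2 := le_iff_forall_block.1 (ht4 n _ (strictShift_mono a (by omega) hp)) j
      have h3 := (strictShift_subset a _ (ht2 n) 0).2
      rw [tail_zero] at h3
      have h3 := le_iff_forall_block.1 h3 j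
      have h4 : block (decPeriodic a m) 0 j = block a 0 j := by
        refine block_eq_iff.2 fun i hi => ?_
        have := decPeriodic_of_lt (a := a) (m := m) (j := i) 0 (by omega)
        rw [mul_zero] at this
        rw [this, zero_add]
      rw [h4] at h2
      have h5 := block_eq_iff.1 (toLex.injective (le_antisymm h3 h2)) i hi
      rwa [zero_add] at h5
    obtain ⟨n, hn⟩ := exists_lt_entropy_of_tendsto ht1 ha hconv hr0 hr
    exact ⟨n₀ + n, by omega, by rwa [ht3 n]⟩
  · push Not at hfin
    obtain ⟨N₀, hN₀⟩ := hfin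
    classical
    have h1free : ReflFree a 1 := fun i hi hi' => by omega
    have hN₀1 : 1 ≤ N₀ := by
      by_contra hlt
      exact hN₀ 1 (by omega) h1free
    set N := Nat.findGreatest (ReflFree a) N₀ with hNdef
    have hN1 : 1 ≤ N := Nat.le_findGreatest hN₀1 h1free
    have hNfree : ReflFree a N := Nat.findGreatest_spec hN₀1 h1free
    have hNlast : ∀ n, N < n → ¬ ReflFree a n := fun n hn => by
      rcases le_or_gt n N₀ with h | h
      · exact Nat.findGreatest_is_greatest hn h
      · exact hN₀ n h
    have hrev := add_eq_rev_of_last_reflFree ha hNfree hNlast hN1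
    have hmem := decPeriodic_mem_strictShift hNfree ha hN1 h0 fun hN => h1 (by rwa [hN] at hrev)
    have heq := strictShift_eq_symmShift hmem fun c hc => le_decPeriodic hN1 hc
    have hmem' := heq ▸ hmem
    refine ⟨max n₀ N, le_max_left _ _, hr.trans_le (le_trans ?_ (entropy_mono ⟨_, hmem⟩ (hinv N)
      (hinv _) (strictShift_mono a (le_max_right n₀ N))))⟩
    rw [heq]
    refine entropy_le_of_ncard_words_le ⟨a, ha⟩ ⟨_, hmem'⟩ (shiftInvariant_symmShift a)
      (shiftInvariant_symmShift _) fun k => ?_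
    have := numWords_le_of_add_eq_rev hN1 ha hmem' (hNfree.pos_last ha hN1 h0) hrev k
    unfold numWords at this
    exact_mod_cast this

/-! ### Bases above the Komornik–Loreti constant -/

lemma val_refl {b : ℝ} (hb : 1 < b) (c : DigitSeq M) : val b (refl c) = M / (b - 1) - val b c := by
  rw [val, ← (hasSum_geom hb (M : ℝ)).tsum_eq, val,
    ← (hasSum_geom hb (M : ℝ)).summable.tsum_sub (summable_val hb c)]
  refine tsum_congr fun i => ?_
  have := Nat.lt_succ_iff.1 (c i).2
  rw [refl, Fin.val_rev, show M + 1 - ((c i : ℕ) + 1) = M - (c i : ℕ) by omega, Nat.cast_sub this,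
    sub_div]

lemma add_one_mem_univoqueBases (hM : 1 ≤ M) : (M : ℝ) + 1 ∈ univoqueBases M := by
  have hM' : (1 : ℝ) ≤ M := by exact_mod_cast hM
  have hb : (1 : ℝ) < (M : ℝ) + 1 := by linarith
  have hdiv : (M : ℝ) / ((M : ℝ) + 1 - 1) = 1 := by
    rw [add_sub_cancel_right, div_self (by linarith)]
  refine ⟨hb, fun _ => Fin.last M, ?_, fun c hc => ?_⟩
  · refine (isExpansion_iff hb).2 (Eq.trans ?_ hdiv)
    exact (hasSum_geom hb (M : ℝ)).tsum_eq
  · have hc := (isExpansion_iff hb).1 hc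
    have h := val_refl hb c
    rw [hc, hdiv, sub_self] at h
    funext i
    by_contra hne
    refine absurd h (val_pos hb (i := i) fun h0 => hne ?_).ne'
    rw [refl] at h0
    rw [← Fin.rev_rev (c i), h0, Fin.rev_zero]

/-- In a base where `1` has a unique expansion no single digit can be changed. -/
lemma not_replace_digit {p : ℝ} (hp : 1 < p) (hpM : p ≤ M + 1) {c : DigitSeq M} (hc : val p c = 1)
    (huniq : ∀ d : DigitSeq M, val p d = 1 → d = c) {i : ℕ} {d : Fin (M + 1)} (hd : d ≠ c i) :
    ¬ (0 ≤ val p (tail c (i + 1)) + ((c i : ℕ) : ℝ) - ((d : ℕ) : ℝ) ∧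
      val p (tail c (i + 1)) + ((c i : ℕ) : ℝ) - ((d : ℕ) : ℝ) ≤ M / (p - 1)) := by
  rintro ⟨h0, h1⟩
  obtain ⟨e, he⟩ := exists_val_eq hp hpM h0 h1
  let c' : DigitSeq M := fun j => if j < i then c j else if j = i then d else e (j - i - 1)
  have hci : c' i = d := by simp [c']
  have htail : tail c' (i + 1) = e := by
    funext j
    simp only [tail, c']
    rw [if_neg (by omega), if_neg (by omega)]
    congr 1; omega
  have h2 := val_sub_val hp (c := c) (d := c') (j := i) fun k hk => by simp [c', hk]
  rw [hci, htail, he] at h2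
  have h3 : val p c' = 1 := by
    rw [← hc, ← sub_eq_zero, h2]
    ring
  exact hd (by rw [← hci, huniq c' h3])

/-- A closed condition satisfied by all bases in which `1` has a unique expansion. With
`K = M / (p - 1)`, uniqueness confines the values of all tails to `[K - 1, 1]`, with strict bounds
after digits that are not extreme, and the condition follows from the bounds for the first two
tails. -/
lemma nonneg_of_mem_univoqueBases (hM : 1 ≤ M) {p : ℝ} (hp : p ∈ univoqueBases M) :
    0 ≤ (p ^ 2 + 1) * (2 * p - 2 - M) - (p ^ 2 - 1) := by
  obtain ⟨hp1, c, hc, huniq⟩ := hp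
  have hc : val p c = 1 := (isExpansion_iff hp1).1 hc
  have huniq : ∀ d : DigitSeq M, val p d = 1 → d = c := fun d hd =>
    huniq d ((isExpansion_iff hp1).2 hd)
  have hp0 : 0 < p - 1 := by linarith
  obtain ⟨K, hK⟩ : ∃ K : ℝ, K = M / (p - 1) := ⟨_, rfl⟩
  have hKM : K * (p - 1) = M := by rw [hK]; field_simp
  have hK1 : 1 ≤ K := by
    have := val_le hp1 c
    rwa [hc, ← hK] at this
  have hpM : p ≤ M + 1 := by nlinarith
  have hM' : (1 : ℝ) ≤ M := by exact_mod_cast hM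
  -- a digit below `M` cannot be increased and a positive digit cannot be decreased
  have hup : ∀ i, (c i : ℕ) < M → val p (tail c (i + 1)) < 1 := by
    intro i hi
    by_contra hlt
    refine not_replace_digit hp1 hpM hc huniq (i := i) (d := ⟨c i + 1, by omega⟩) ?_ ?_
    · intro h; have := congrArg Fin.val h; simp at this
    · have := val_le hp1 (tail c (i + 1))
      push_cast
      constructor <;> linarith
  have hlow : ∀ i, 0 < (c i : ℕ) → K - 1 < val p (tail c (i + 1)) := by
    intro i hi
    by_contra hlt
    refine not_replace_digit hp1 hpM hc huniq (i := i) (d := ⟨c i - 1, by omega⟩) ?_ ?_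
    · intro h; have := congrArg Fin.val h; simp at this; omega
    · have := val_nonneg hp1 (tail c (i + 1))
      simp only [Nat.cast_sub (Nat.succ_le_of_lt hi), Nat.cast_one]
      rw [← hK]
      constructor <;> linarith
  have hr1 : val p (tail c 1) = p - ((c 0 : ℕ) : ℝ) := by
    have := val_tail hp1 c 0
    rw [tail_zero, hc, mul_one] at this
    exact this
  have hr2 := val_tail hp1 c 1
  have hdig : ∀ i, (c i : ℕ) ≤ M := fun i => Nat.lt_succ_iff.1 (c i).2
  have hK2 : K ≤ 2 := by
    by_contra hlt
    rcases (hdig 0).lt_or_eq with h | h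
    · have h1 := hup 0 h
      rw [zero_add] at h1
      rcases Nat.eq_zero_or_pos (c 0 : ℕ) with h0 | h0
      · rw [hr1, h0] at h1
        push_cast at h1
        linarith
      · have h2 := hlow 0 h0
        rw [zero_add] at h2
        linarith
    · have h2 := hlow 0 (by omega)
      rw [zero_add, hr1, h] at h2
      linarith
  have hbd : ∀ i, K - 1 ≤ val p (tail c i) ∧ val p (tail c i) ≤ 1 := by
    intro i
    induction i with
    | zero => rw [tail_zero, hc]; exact ⟨by linarith, le_rfl⟩
    | succ i ih =>
      have hrec := val_tail hp1 c i
      refine ⟨?_, ?_⟩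
      · rcases Nat.eq_zero_or_pos (c i : ℕ) with h0 | h0
        · rw [hrec, h0]
          push_cast
          nlinarith [ih.1]
        · exact (hlow i h0).le
      · rcases (hdig i).lt_or_eq with h | h
        · exact (hup i h).le
        · rw [hrec, h]
          nlinarith [ih.2]
  obtain ⟨hb1, hb1'⟩ := hbd 1
  obtain ⟨hb2, hb2'⟩ := hbd 2
  rw [show (2 : ℕ) = 1 + 1 from rfl, hr2] at hb2 hb2'
  rw [hr1] at hb1 hb1' hb2 hb2'
  suffices h : p + 1 ≤ (p ^ 2 + 1) * (2 - K) by
    rw [← hKM]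
    nlinarith
  have hc0 : M ≤ 2 * (c 0 : ℕ) := by
    have : (M : ℝ) ≤ 2 * ((c 0 : ℕ) : ℝ) := by nlinarith
    exact_mod_cast this
  -- the cases `2 c_0 - M = 0`, `= 1` and `≥ 2`; only the second one needs the second tail
  rcases hc0.eq_or_lt with h0 | h0
  · have h1 := hup 0 (by omega)
    rw [zero_add, hr1] at h1
    have h2 : (M : ℝ) = 2 * ((c 0 : ℕ) : ℝ) := by exact_mod_cast h0
    nlinarith
  rcases (Nat.succ_le_of_lt h0).eq_or_lt with h0 | h0
  · have h1 := hlow 0 (by omega)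
    rw [zero_add, hr1] at h1
    have h2 : (M : ℝ) + 1 = 2 * ((c 0 : ℕ) : ℝ) := by exact_mod_cast h0
    rcases le_or_gt (M + 1) (2 * (c 1 : ℕ)) with h3 | h3
    · have h4 : (M : ℝ) + 1 ≤ 2 * ((c 1 : ℕ) : ℝ) := by exact_mod_cast h3
      nlinarith
    · exfalso
      have h4 : 2 * (c 1 : ℕ) + 1 ≤ M := by omega
      have h5 : 2 * ((c 1 : ℕ) : ℝ) + 1 ≤ M := by exact_mod_cast h4
      have h6 : (p + 1) * (2 - K) > 1 := by nlinarith
      have h7 : (p - 1) * (2 * p + 1 - K * (p + 1)) ≤ 0 := by nlinarith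
      nlinarith
  · have h2 : (M : ℝ) + 2 ≤ 2 * ((c 0 : ℕ) : ℝ) := by exact_mod_cast h0
    have h6 : (p + 1) * (2 - K) ≥ 2 := by nlinarith
    nlinarith [sq_nonneg (p - 1)]

/-- The bound on the base that follows from `q ≥ q'`; it says that `alternating M` has value smaller
than `1` in base `q`. -/
lemma base_bound (hM : 1 ≤ M) {q : ℝ} (hq : komornikLoreti M ≤ q) :
    1 < q ∧ q - 1 < (q + 1) * (2 * q - 2 - M) := by
  have hM' : (1 : ℝ) ≤ M := by exact_mod_cast hM
  have hne : (univoqueBases M).Nonempty := ⟨_, add_one_mem_univoqueBases hM⟩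
  have hbdd : BddBelow (univoqueBases M) := ⟨1, fun p hp => hp.1.le⟩
  have hcl : IsClosed ({p : ℝ | 1 ≤ p} ∩
      {p : ℝ | 0 ≤ (p ^ 2 + 1) * (2 * p - 2 - M) - (p ^ 2 - 1)}) :=
    (isClosed_le continuous_const continuous_id).inter
      (isClosed_le continuous_const (by fun_prop))
  obtain ⟨h1, h2⟩ := hcl.closure_subset_iff.2
    (fun p hp => ⟨hp.1.le, nonneg_of_mem_univoqueBases hM hp⟩) (csInf_mem_closure hne hbdd)
  rw [← komornikLoreti] at h1 h2
  generalize komornikLoreti M = p at h1 h2 hq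
  replace h1 : 1 ≤ p := h1
  replace h2 : 0 ≤ (p ^ 2 + 1) * (2 * p - 2 - M) - (p ^ 2 - 1) := h2
  have h3 : 1 < p := by
    refine lt_of_le_of_ne h1 ?_
    rintro rfl
    norm_num at h2
    linarith
  have h4 : 0 < 2 * p - 2 - M := by
    by_contra hlt
    nlinarith
  have h5 : p - 1 < (p + 1) * (2 * p - 2 - M) := by
    have : (p - 1) * (p ^ 2 + 1) < (p + 1) * (2 * p - 2 - M) * (p ^ 2 + 1) := by
      linarith [mul_pos (sub_pos.2 h3) (show 0 < p by linarith),
        mul_nonneg (show 0 ≤ p + 1 by linarith) h2]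
    exact lt_of_mul_lt_mul_right this (by positivity)
  refine ⟨h3.trans_le hq, ?_⟩
  nlinarith

/-- The periodic sequence with period `h (M - h)`, `h = ⌈M / 2⌉`: the least sequence for which
`symmShift` is nonempty. -/
def alternating (M : ℕ) : DigitSeq M := fun n =>
  if Even n then ⟨(M + 1) / 2, by omega⟩ else ⟨M - (M + 1) / 2, by omega⟩

lemma tail_alternating : tail (alternating M) 1 = refl (alternating M) := by
  funext n
  simp only [tail, refl, alternating, add_comm 1 n, Nat.even_add_one]
  by_cases hn : Even n
  · simp only [hn, not_true_eq_false, if_true, if_false]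
    ext
    simp
  · simp only [hn, not_false_eq_true, if_true, if_false]
    ext
    simp only [Fin.val_rev]
    omega

lemma tail_alternating_eq (m : ℕ) :
    tail (alternating M) m = alternating M ∨ tail (alternating M) m = refl (alternating M) := by
  induction m with
  | zero => exact Or.inl (tail_zero _)
  | succ m ih =>
    rw [← tail_tail]
    rcases ih with h | h <;> rw [h]
    · exact Or.inr tail_alternating
    · rw [tail_refl, tail_alternating, refl_refl]
      exact Or.inl rfl

lemma refl_alternating_le : toLex (refl (alternating M)) ≤ toLex (alternating M) := by
  rcases Nat.even_or_odd M with hM | hM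
  · refine le_of_eq (congrArg toLex (funext fun n => ?_))
    obtain ⟨k, rfl⟩ := hM
    simp only [refl, alternating]
    ext
    split_ifs <;> simp only [Fin.val_rev] <;> omega
  · refine (lex_lt_iff.2 ⟨0, fun i hi => absurd hi (Nat.not_lt_zero i), ?_⟩).le
    obtain ⟨k, rfl⟩ := hM
    simp only [refl, alternating, Even.zero, if_true, Fin.lt_def, Fin.val_rev]
    omega

variable {q : ℝ}

lemma alternating_lt_alpha (hq : 1 < q) (hqM : q ≤ M + 1)
    (hb : q - 1 < (q + 1) * (2 * q - 2 - M)) : toLex (alternating M) < toLex (alpha M q) := by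
  by_contra hle
  have hle := not_lt.1 hle
  have hV : val q (refl (alternating M)) = M / (q - 1) - val q (alternating M) := val_refl hq _
  have h1 := val_tail hq (alternating M) 0
  rw [zero_add, tail_alternating, tail_zero, hV] at h1
  have h0 : ((alternating M 0 : ℕ) : ℝ) = ((M + 1) / 2 : ℕ) := by simp [alternating]
  have h2 : 2 * (((M + 1) / 2 : ℕ) : ℝ) ≤ M + 1 := by
    have : 2 * ((M + 1) / 2) ≤ M + 1 := by omega
    exact_mod_cast this
  have h2' : (M : ℝ) ≤ 2 * (((M + 1) / 2 : ℕ) : ℝ) := by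
    have : M ≤ 2 * ((M + 1) / 2) := by omega
    exact_mod_cast this
  rw [h0] at h1
  have hq1 : 0 < q - 1 := by linarith
  obtain ⟨K, hK⟩ : ∃ K : ℝ, K = M / (q - 1) := ⟨_, rfl⟩
  have hKM : K * (q - 1) = M := by rw [hK]; field_simp
  rw [← hK] at h1 hV
  have h3 : val q (alpha M q) ≤ val q (alternating M) := by
    refine val_le_val_of_tail_le hq (fun m => (tail_alpha_le hq hqM m).trans hle) fun m => ?_
    rcases tail_alternating_eq (M := M) m with h | h <;> rw [h]
    · linarith
    · rw [hV]
      nlinarith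
  rw [val_alpha hq hqM] at h3
  have h4 : (q + 1) * (q - 1) ≤ (((M + 1) / 2 : ℕ) + K) * (q - 1) :=
    mul_le_mul_of_nonneg_right (by nlinarith) hq1.le
  nlinarith

lemma lt_two_mul_alpha_zero (hq : 1 < q) (hqM : q ≤ M + 1)
    (hb : q - 1 < (q + 1) * (2 * q - 2 - M)) : M < 2 * (alpha M q 0 : ℕ) := by
  have hlt := alternating_lt_alpha hq hqM hb
  have h1 : (M + 1) / 2 ≤ (alpha M q 0 : ℕ) := by
    have := Fin.le_def.1
      (le_of_forall_lt_eq hlt.le (j := 0) fun i hi => absurd hi (Nat.not_lt_zero i))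
    simpa [alternating] using this
  by_contra hle
  obtain ⟨j, -, hj⟩ := lex_lt_iff.1 hlt
  have h2 := Fin.le_def.1
    (le_of_forall_lt_eq (tail_alpha_le hq hqM j) (j := 0) fun i hi => absurd hi (Nat.not_lt_zero i))
  have h3 := Fin.lt_def.1 hj
  simp only [tail, add_zero] at h2
  simp only [alternating] at h3
  split_ifs at h3 <;> simp only at h3 <;> omega

lemma lt_two_mul_alpha_zero_of_eq_rev (hq : 1 < q) (hqM : q ≤ M + 1)
    (hb : q - 1 < (q + 1) * (2 * q - 2 - M))
    (hrev : ∀ j, alpha M q (1 + j) = (alpha M q j).rev) : M + 1 < 2 * (alpha M q 0 : ℕ) := by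
  by_contra hle
  have h0 := lt_two_mul_alpha_zero hq hqM hb
  refine absurd (alternating_lt_alpha hq hqM hb) (not_lt.2 (le_of_eq (congrArg toLex ?_)))
  funext n
  induction n with
  | zero =>
    ext
    simp only [alternating, Even.zero, if_true]
    omega
  | succ n ih =>
    rw [add_comm n 1, hrev, ih]
    exact (congrFun tail_alternating n).symm

lemma exists_strictShift_alpha_nonempty (hq : 1 < q) (hqM : q ≤ M + 1)
    (hb : q - 1 < (q + 1) * (2 * q - 2 - M)) : ∃ n, (strictShift (alpha M q) n).Nonempty := by
  obtain ⟨n, hn⟩ := lt_iff_exists_block.1 (alternating_lt_alpha hq hqM hb)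
  have key : ∀ m, toLex (block (alternating M) m n) < toLex (block (alpha M q) 0 n) := by
    intro m
    refine lt_of_le_of_lt ?_ hn
    have h : toLex (tail (alternating M) m) ≤ toLex (alternating M) := by
      rcases tail_alternating_eq (M := M) m with h | h <;> rw [h]
      exact refl_alternating_le
    have := le_iff_forall_block.1 h n
    rwa [block_tail, add_zero] at this
  refine ⟨n, alternating M, fun m => ⟨?_, key m⟩⟩
  have h := key (m + 1)
  have h1 : block (alternating M) (m + 1) n = block (refl (alternating M)) m n := by
    rw [← tail_alternating, block_tail, add_comm]
  rw [h1, ← refl_refl (alpha M q)] at h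
  exact block_refl_lt_block_refl.1 h

/-! ### Approximation of the entropy from outside -/

/-- The sequences all of whose blocks of length `n` lie between the initial blocks of the reflection
of `a` and of `a`, bounds included. -/
def weakShift (a : DigitSeq M) (n : ℕ) : Set (DigitSeq M) :=
  {c | ∀ m : ℕ, toLex (block (refl a) 0 n) ≤ toLex (block c m n) ∧
    toLex (block c m n) ≤ toLex (block a 0 n)}

lemma weakShift_antitone (a : DigitSeq M) : Antitone (weakShift a) :=
  fun _ _ hn _ hc m => ⟨block_le_anti hn (hc m).1, block_le_anti hn (hc m).2⟩

lemma shiftInvariant_weakShift (a : DigitSeq M) (n : ℕ) : ShiftInvariant (weakShift a n) := by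
  intro c hc m l
  rw [block_tail]
  exact hc _

lemma isClosed_weakShift (a : DigitSeq M) (n : ℕ) : IsClosed (weakShift a n) :=
  isClosed_setOf_block
    fun w => toLex (block (refl a) 0 n) ≤ toLex w ∧ toLex w ≤ toLex (block a 0 n)

lemma iInter_weakShift (a : DigitSeq M) : ⋂ n, weakShift a n = symmShift a := by
  ext c
  rw [Set.mem_iInter]
  constructor
  · refine fun h m => ⟨le_iff_forall_block.2 fun n => ?_, le_iff_forall_block.2 fun n => ?_⟩
    · simpa using (h n m).1
    · simpa using (h n m).2
  · refine fun h n m => ⟨?_, ?_⟩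
    · simpa using le_iff_forall_block.1 (h m).1 n
    · simpa using le_iff_forall_block.1 (h m).2 n

lemma isClosed_symmShift (a : DigitSeq M) : IsClosed (symmShift a) :=
  iInter_weakShift a ▸ isClosed_iInter (isClosed_weakShift a)

lemma tendsto_entropy_weakShift {a : DigitSeq M} (hne : (symmShift a).Nonempty) :
    Tendsto (fun n => entropy (weakShift a n)) atTop (𝓝 (entropy (symmShift a))) :=
  tendsto_entropy_of_antitone (weakShift_antitone a) (isClosed_weakShift a)
    (shiftInvariant_weakShift a) (iInter_weakShift a) hne (shiftInvariant_symmShift a)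

lemma symmShift_beta_eq {q : ℝ} (hq : 1 < q) (hqM : q ≤ M + 1) :
    symmShift (beta M q) = symmShift (alpha M q) := by
  refine Set.Subset.antisymm (fun c hc m => ?_) (symmShift_mono (alpha_le_beta hq hqM))
  have key : ∀ c ∈ symmShift (beta M q), toLex (tail c m) ≤ toLex (alpha M q) := fun c hc =>
    tail_le_alpha_of_tail_le_beta hq hqM (shiftInvariant_symmShift _ c hc m)
  refine ⟨?_, key c hc⟩
  rw [← refl_refl (tail c m)]
  exact refl_le_refl.2 (key _ (refl_mem_symmShift hc))

lemma shiftInvariant_setU (M : ℕ) (q : ℝ) : ShiftInvariant (setU M q) := by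
  intro c hc m n
  rw [tail_tail]
  exact hc _

lemma strictShift_subset_setU (M : ℕ) (q : ℝ) (n : ℕ) :
    strictShift (alpha M q) n ⊆ setU M q := by
  refine fun c hc m => ⟨lt_iff_exists_block.2 ⟨n, ?_⟩, lt_iff_exists_block.2 ⟨n, ?_⟩⟩
  · simpa using (hc m).1
  · simpa using (hc m).2

lemma setU_subset (M : ℕ) (q : ℝ) : setU M q ⊆ symmShift (alpha M q) :=
  fun _ hc m => ⟨(hc m).1.le, (hc m).2.le⟩

end Univoque

open Univoque in
theorem proposition2p8 (M : ℕ) (hM : 1 ≤ M) (q : ℝ)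
    (hq : q ∈ Set.Icc (Univoque.komornikLoreti M) ((M : ℝ) + 1)) :
    -- all entropies that occur are well defined
    (Univoque.EntropyDefined (Univoque.setU M q) ∧
      Univoque.EntropyDefined (Univoque.setV M q) ∧
      (∀ n : ℕ, 1 ≤ n → (Univoque.setUn M q n).Nonempty →
        Univoque.EntropyDefined (Univoque.setUn M q n)) ∧
      (∀ᶠ n : ℕ in atTop, (Univoque.setUn M q n).Nonempty) ∧
      (∀ n : ℕ, 1 ≤ n → Univoque.EntropyDefined (Univoque.setVn M q n)) ∧
      (∀ n : ℕ, 1 ≤ n → Univoque.EntropyDefined (Univoque.setWn M q n))) ∧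
    -- the limits and the equality
    Tendsto (fun n : ℕ => Univoque.entropy (Univoque.setUn M q n)) atTop
      (𝓝 (Univoque.entropy (Univoque.setU M q))) ∧
    Tendsto (fun n : ℕ => Univoque.entropy (Univoque.setVn M q n)) atTop
      (𝓝 (Univoque.entropy (Univoque.setU M q))) ∧
    Tendsto (fun n : ℕ => Univoque.entropy (Univoque.setWn M q n)) atTop
      (𝓝 (Univoque.entropy (Univoque.setU M q))) ∧
    Univoque.entropy (Univoque.setU M q) = Univoque.entropy (Univoque.setV M q) := by
  obtain ⟨hq1, hb⟩ := base_bound hM hq.1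
  have hqM := hq.2
  obtain ⟨n₀, hne⟩ := exists_strictShift_alpha_nonempty hq1 hqM hb
  set a := alpha M q with ha
  have hUinv := shiftInvariant_setU M q
  have hVinv := shiftInvariant_symmShift a
  have hneU := hne.mono (strictShift_subset_setU M q n₀)
  have hneV := hneU.mono (setU_subset M q)
  have hneUn : ∀ n, n₀ ≤ n → (strictShift a n).Nonempty := fun n hn =>
    hne.mono (strictShift_mono a hn)
  have hneVn : ∀ n, (weakShift a n).Nonempty := fun n =>
    hneV.mono (iInter_weakShift a ▸ Set.iInter_subset _ n)
  have hneW : (symmShift (beta M q)).Nonempty := by rwa [symmShift_beta_eq hq1 hqM]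
  have hneWn : ∀ n, (weakShift (beta M q) n).Nonempty := fun n =>
    hneW.mono (iInter_weakShift (beta M q) ▸ Set.iInter_subset _ n)
  have hUV : entropy (setU M q) ≤ entropy (symmShift a) :=
    entropy_mono hneU hUinv hVinv (setU_subset M q)
  have hUn : ∀ n, n₀ ≤ n → entropy (strictShift a n) ≤ entropy (setU M q) := fun n hn =>
    entropy_mono (hneUn n hn) (shiftInvariant_strictShift a n) hUinv
      (strictShift_subset_setU M q n)
  have hlim : ∀ r < entropy (symmShift a), ∃ n, n₀ ≤ n ∧ r < entropy (strictShift a n) :=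
    fun r hr => exists_lt_entropy_strictShift (isClosed_symmShift a) hne
      (lt_two_mul_alpha_zero hq1 hqM hb) (lt_two_mul_alpha_zero_of_eq_rev hq1 hqM hb) hr
  have heq : entropy (setU M q) = entropy (symmShift a) := by
    refine le_antisymm hUV (le_of_forall_lt fun r hr => ?_)
    obtain ⟨n, hn, hrn⟩ := hlim r hr
    exact hrn.trans_le (hUn n hn)
  refine ⟨⟨entropyDefined hneU hUinv, entropyDefined hneV hVinv,
    fun n _ h => entropyDefined h (shiftInvariant_strictShift a n),
    (eventually_ge_atTop n₀).mono hneUn,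
    fun n _ => entropyDefined (hneVn n) (shiftInvariant_weakShift a n),
    fun n _ => entropyDefined (hneWn n) (shiftInvariant_weakShift _ n)⟩, ?_, ?_, ?_, heq⟩
  · refine tendsto_order.2 ⟨fun r hr => ?_, fun r hr => ?_⟩
    · obtain ⟨n, hn, hrn⟩ := hlim r (heq ▸ hr)
      filter_upwards [eventually_ge_atTop n] with l hl
      exact hrn.trans_le (entropy_mono (hneUn n hn) (shiftInvariant_strictShift a n)
        (shiftInvariant_strictShift a l) (strictShift_mono a hl))
    · filter_upwards [eventually_ge_atTop n₀] with n hn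
      exact (hUn n hn).trans_lt hr
  · rw [heq]
    exact tendsto_entropy_weakShift hneV
  · rw [heq, ha, ← symmShift_beta_eq hq1 hqM]
    exact tendsto_entropy_weakShift hneW
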